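/- For every $n \ge 1$ let $T_1,\dots,T_n$ be i.i.d. random variables, uniformly distributed on $[0,1]$ (for each $n$ one may take a different family), with order statistics $T_{(1)} \le \dots \le T_{(n)}$, and put $T_{(0)} := 0$. Let $\nu_1,\nu_2,\dots$ be i.i.d. random variables, independent of the $T_i$, with $\mathbb P(\nu_1>0)=1$ and cumulant generating function $\varphi(\theta) = \log \mathbb E[e^{\theta \nu_1}] \in (-\infty,+\infty]$, and assume that $0$ is an interior point of $\{\theta\in\mathbb R : \varphi(\theta)<\infty\}$. Fix $t \in (0,1]$ and define $$T^n(t) = T_{(\lfloor nt\rfloor)},\qquad S^n(t) = \frac1n\sum_{i=1}^{\lfloor nt\rfloor}\nu_i,\qquad X^n(t) = S^n(t)-T^n(t).$$ For $x_1\in[0,1]$ and $x_2\in[0,\infty)$ let $$I_t(x_1) = t\log\frac{t}{x_1} + (1-t)\log\frac{1-t}{1-x_1},\qquad \Lambda_t^*(x_2) = \sup_{\theta\in\mathbb R}\{\theta x_2 - t\varphi(\theta)\}$$ (with $0\log(0/b) = 0$ for $b \ge 0$, and $a\log(a/0)=+\infty$ for $a>0$), and for $y\in\mathbb R$ let $$J_t(y)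 = \inf\{\, I_t(x_1)+\Lambda_t^*(x_2) \;:\; x_1\in[0,1],\ x_2\in[0,\infty),\ x_2 = x_1 + y \,\}\in[0,\infty],\qquad \inf\emptyset=+\infty.$$ **Proposition.** $J_t$ is a good rate function on $\mathbb R$, that is, it is lower semicontinuous with values in $[0,\infty]$ and its level sets $\{y : J_t(y)\le\alpha\}$, $0\le\alpha<\infty$, are compact; and $(X^n(t))_{n\ge1}$ satisfies the large deviation principle with rate function $J_t$: for every open $G\subseteq\mathbb R$ and every closed $F\subseteq\mathbb R$, $$\liminf_{n\to\infty}\frac1n\log\mathbb P(X^n(t)\in G)\ \ge\ -\inf_{y\in G}J_t(y),\qquad \limsup_{n\to\infty}\frac1n\log\mathbb P(X^n(t)\in F)\ \le\ -\inf_{y\in F}J_t(y).$$ -/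

import Mathlib

open MeasureTheory ProbabilityTheory Filter Topology Set

noncomputable section

namespace OfferedLoad

/-- A good rate function: a lower semicontinuous function with values in `[0, ∞]` all of whose
level sets at finite levels are compact. -/
structure IsGoodRateFunction {E : Type*} [TopologicalSpace E] (I : E → EReal) : Prop where
  nonneg : ∀ x, 0 ≤ I x
  lowerSemicontinuous : LowerSemicontinuous I
  isCompact_levelSet : ∀ α : ℝ, IsCompact {x | I x ≤ (α : EReal)}

/-- The large deviation principle (at speed `n`) with rate function `I` for the sequence
`X 1, X 2, …`. The logarithm is extended real valued, `log 0 = -∞`, and the infimum over the empty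
set is `+∞`. -/
structure SatisfiesLDP {Ω E : Type*} [MeasurableSpace Ω] [TopologicalSpace E]
    (P : Measure Ω) (X : ℕ → Ω → E) (I : E → EReal) : Prop where
  lower : ∀ G : Set E, IsOpen G →
    -(⨅ x ∈ G, I x) ≤
      liminf (fun n : ℕ => ((1 / (n : ℝ) : ℝ) : EReal) * ENNReal.log (P {ω | X n ω ∈ G})) atTop
  upper : ∀ F : Set E, IsClosed F →
    limsup (fun n : ℕ => ((1 / (n : ℝ) : ℝ) : EReal) * ENNReal.log (P {ω | X n ω ∈ F})) atTop ≤
      -(⨅ x ∈ F, I x)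

/-- The `j`-th order statistic (the `j`-th smallest entry, `1 ≤ j ≤ n`) of a vector of length `n`,
and `0` for `j = 0`. (The value for `j > n` is irrelevant.) -/
def orderStat {n : ℕ} (v : Fin n → ℝ) (j : ℕ) : ℝ :=
  if h : 1 ≤ j ∧ j ≤ n then v (Tuple.sort v ⟨j - 1, by omega⟩) else 0

/-- The ordered statistics process `T^n(t) = T_(⌊nt⌋)`; `T n i` is the arrival epoch of the
`i`-th of `n` jobs. -/
def arrivalProcess {Ω : Type*} (T : (n : ℕ) → Fin n → Ω → ℝ) (n : ℕ) (t : ℝ) (ω : Ω) : ℝ :=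
  orderStat (fun i => T n i ω) ⌊(n : ℝ) * t⌋₊

/-- The service process: `n⁻¹` times the sum of the first `⌊nt⌋` service times. The service times
are `ν 0, ν 1, …`. -/
def serviceProcess {Ω : Type*} (ν : ℕ → Ω → ℝ) (n : ℕ) (t : ℝ) (ω : Ω) : ℝ :=
  (∑ i ∈ Finset.range ⌊(n : ℝ) * t⌋₊, ν i ω) / n

/-- The offered load `X^n(t) = S^n(t) - T^n(t)`. -/
def offeredLoad {Ω : Type*} (T : (n : ℕ) → Fin n → Ω → ℝ) (ν : ℕ → Ω → ℝ)
    (n : ℕ) (t : ℝ) (ω : Ω) : ℝ :=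
  serviceProcess ν n t ω - arrivalProcess T n t ω

/-- `a log (a / b)` for `a, b ≥ 0`, with the values `0` for `a = 0` and `+∞` for `a > 0 = b`. -/
def mulLogDiv (a b : ℝ) : EReal :=
  if a = 0 then 0 else if b = 0 then ⊤ else ((a * Real.log (a / b) : ℝ) : EReal)

/-- `I_t(x) = t log (t / x) + (1 - t) log ((1 - t) / (1 - x))`, for `x ∈ [0, 1]`. -/
def arrivalRate (t x : ℝ) : EReal :=
  mulLogDiv t x + mulLogDiv (1 - t) (1 - x)

/-- `Λ*_t(x) = sup_θ (θ x - t φ(θ))`, where `φ` is the cumulant generating function of `V`.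
Here `t > 0`; the points `θ` with `φ(θ) = +∞` contribute `-∞` to the supremum, so it is taken over
the set of `θ` at which `φ` is finite. -/
def serviceRate {Ω : Type*} [MeasurableSpace Ω] (P : Measure Ω) (V : Ω → ℝ) (t x : ℝ) : EReal :=
  ⨆ θ ∈ integrableExpSet V P, ((θ * x - t * cgf V P θ : ℝ) : EReal)

/-- `J_t(y)`, the infimum of `I_t(x₁) + Λ*_t(x₂)` over all `x₁ ∈ [0, 1]` (an arrival epoch) and
`x₂ ∈ [0, ∞)` (an amount of service) with `x₂ - x₁ = y`. -/
def offeredLoadRate {Ω : Type*} [MeasurableSpace Ω] (P : Measure Ω) (V : Ω → ℝ) (t y : ℝ) :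
    EReal :=
  ⨅ x ∈ {x : ℝ × ℝ | x ∈ Icc (0 : ℝ) 1 ×ˢ Ici (0 : ℝ) ∧ x.2 = x.1 + y},
    (arrivalRate t x.1 + serviceRate P V t x.2)

end OfferedLoad

end

/-! The arrival epoch and the amount of service are independent, so at exponential scale the pair
costs `arrivalRate + serviceRate`. The offered load is the image of the pair under the continuous
map `x ↦ x.2 - x.1`, and its rate is the infimum of the joint rate over fibres, as in the
contraction principle. It is enough to estimate each factor near a single point and multiply.

Arrivals: sorting an event on the `k`-th order statistic by the set of the `k` smallest entries
bounds its probability on both sides by a binomial coefficient times explicit powers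
(`uniformLaw_orderStat_le`, `le_uniformLaw_orderStat`). With `k = ⌊nt⌋`, entropy estimates for the
coefficient yield the relative entropy of `t` with respect to `x`.

Services: the upper bound is Chernoff's. The lower bound is Cramér's
(`eventually_le_pi_abs_sum_le`), where the supremum defining the rate need not be attained.
Truncating the law makes its moment generating function finite everywhere; tilting at a minimiser
centres the law, and Chebyshev's inequality applies. A compactness argument removes the truncation;
laws on a half-line reduce to their atom at `0`.

Assembly: for closed sets, a finite cover of a compact set of pairs is combined with a Chernoff
bound on large service; for open sets, one pair of finite rate at a time suffices. Goodness holds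
because joint level sets are compact and the infimum over a fibre is attained at finite levels. -/

noncomputable section

namespace OfferedLoad

/-! ### Cramér's lower bound by truncation and tilting -/

section Cramer

/-- A product of measures with density has the product density. -/
lemma pi_withDensity {α : Type*} [MeasurableSpace α] {ι : Type*} [Fintype ι]
    (μ : Measure α) [IsProbabilityMeasure μ] {g : α → ENNReal} (hg : Measurable g)
    [IsProbabilityMeasure (μ.withDensity g)] :
    Measure.pi (fun _ : ι => μ.withDensity g) =
      (Measure.pi fun _ : ι => μ).withDensity (fun y => ∏ i, g (y i)) := by
  refine Measure.pi_eq fun s hs => ?_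
  have hind : iIndepFun (fun (i : ι) (y : ι → α) => (s i).indicator g (y i))
      (Measure.pi fun _ : ι => μ) :=
    iIndepFun_pi (X := fun i => (s i).indicator g)
      fun i => (hg.indicator (hs i)).aemeasurable
  have hprod : ∀ y : ι → α, (univ.pi s).indicator (fun y => ∏ i, g (y i)) y =
      ∏ i, (s i).indicator g (y i) := by
    intro y
    by_cases hy : y ∈ univ.pi s
    · rw [indicator_of_mem hy]
      exact Finset.prod_congr rfl fun i _ => (indicator_of_mem (hy i (mem_univ i)) g).symm
    · rw [indicator_of_notMem hy]
      simp only [mem_univ_pi, not_forall] at hy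
      obtain ⟨i, hi⟩ := hy
      exact (Finset.prod_eq_zero (Finset.mem_univ i) (indicator_of_notMem hi g)).symm
  rw [withDensity_apply _ (MeasurableSet.univ_pi hs),
    ← lintegral_indicator (MeasurableSet.univ_pi hs), lintegral_congr hprod,
    lintegral_prod_eq_prod_lintegral_of_indepFun _ _ hind
      (fun i => (hg.indicator (hs i)).comp (measurable_pi_apply i))]
  refine Finset.prod_congr rfl fun i _ => ?_
  rw [withDensity_apply _ (hs i), ← lintegral_indicator (hs i)]
  exact ((measurePreserving_eval (fun _ : ι => μ) i).lintegral_comp (hg.indicator (hs i)))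

/-- Chebyshev's inequality for sums of independent copies of a centred square integrable law. -/
lemma eventually_half_le_pi (ρ : Measure ℝ) [IsProbabilityMeasure ρ] (hρ : MemLp id 2 ρ)
    (hmean : ∫ y, y ∂ρ = 0) {δ : ℝ} (hδ : 0 < δ) :
    ∀ᶠ m : ℕ in atTop, (2 : ENNReal)⁻¹ ≤
      Measure.pi (fun _ : Fin m => ρ) {y | |∑ i, y i| ≤ m * δ} := by
  have hlim : Tendsto (fun m : ℕ => Var[id; ρ] / (δ ^ 2) / (m : ℝ)) atTop (𝓝 0) :=
    tendsto_const_div_atTop_nhds_zero_nat _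
  filter_upwards [hlim.eventually_lt_const (show (0 : ℝ) < 2⁻¹ by norm_num),
    eventually_gt_atTop 0] with m hm hm0
  have hm0' : (0 : ℝ) < m := by exact_mod_cast hm0
  set Q := Measure.pi (fun _ : Fin m => ρ)
  have hL : ∀ i : Fin m, MemLp (fun y : Fin m → ℝ => y i) 2 Q := fun i =>
    hρ.comp_measurePreserving (measurePreserving_eval (fun _ : Fin m => ρ) i)
  have hS : MemLp (∑ i, fun y : Fin m → ℝ => y i) 2 Q := memLp_finsetSum' _ fun i _ => hL i
  have hvar : Var[∑ i, fun y : Fin m → ℝ => y i; Q] = m * Var[id; ρ] := by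
    have := variance_sum_pi (μ := fun _ : Fin m => ρ) (X := fun _ => id) (fun _ => hρ)
    simpa using this
  have hint : ∫ y, (∑ i, fun y : Fin m → ℝ => y i) y ∂Q = 0 := by
    simp only [Finset.sum_apply]
    rw [integral_finsetSum _ fun i _ => (hL i).integrable one_le_two]
    refine Finset.sum_eq_zero fun i _ => ?_
    rw [← hmean]
    exact integral_comp_eval (μ := fun _ : Fin m => ρ) (f := fun y : ℝ => y)
      aestronglyMeasurable_id
  have hcheb := meas_ge_le_variance_div_sq hS (mul_pos hm0' hδ)
  rw [hint, hvar] at hcheb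
  simp only [Finset.sum_apply, sub_zero] at hcheb
  have h2 : Q {y | (m : ℝ) * δ ≤ |∑ i, y i|} ≤ 2⁻¹ := by
    refine hcheb.trans ?_
    have : (2 : ENNReal)⁻¹ = ENNReal.ofReal 2⁻¹ := by
      rw [ENNReal.ofReal_inv_of_pos two_pos]; simp
    rw [this]
    refine ENNReal.ofReal_le_ofReal (le_of_eq_of_le ?_ hm.le)
    field_simp
  have hcompl : (1 : ENNReal) ≤ Q {y | |∑ i, y i| ≤ m * δ} + 2⁻¹ := by
    rw [← measure_univ (μ := Q)]
    refine (measure_mono fun y _ => ?_).trans ((measure_union_le _ _).trans (add_le_add_right h2 _))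
    rcases le_total (|∑ i, y i|) (m * δ) with h | h
    · exact Or.inl h
    · exact Or.inr h
  rw [← ENNReal.inv_two_add_inv_two] at hcompl
  exact (ENNReal.add_le_add_iff_right (by simp)).1 hcompl

/-- The moment generating function of a law truncated to `[-M, M]`. -/
def truncMgf (μ : Measure ℝ) (M θ : ℝ) : ℝ := mgf id (μ.restrict (Icc (-M) M)) θ

variable {μ : Measure ℝ} [IsProbabilityMeasure μ]

lemma integrable_exp_mul_restrict_Icc (M θ : ℝ) :
    Integrable (fun y => Real.exp (θ * id y)) (μ.restrict (Icc (-M) M)) := by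
  have : IntegrableOn (fun y : ℝ => Real.exp (θ * y)) (Icc (-M) M) μ :=
    ContinuousOn.integrableOn_compact isCompact_Icc (by fun_prop)
  exact this

lemma mem_interior_integrableExpSet_restrict_Icc (M θ : ℝ) :
    θ ∈ interior (integrableExpSet id (μ.restrict (Icc (-M) M))) := by
  have : integrableExpSet id (μ.restrict (Icc (-M) M)) = univ :=
    eq_univ_of_forall fun θ => integrable_exp_mul_restrict_Icc M θ
  simp [this]

lemma continuous_truncMgf (M : ℝ) : Continuous (truncMgf μ M) :=
  continuous_mgf fun θ => integrable_exp_mul_restrict_Icc M θ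

lemma truncMgf_mono (θ : ℝ) : Monotone fun M => truncMgf μ M θ := by
  intro M M' h
  refine integral_mono_measure (Measure.restrict_mono (Icc_subset_Icc (by linarith) h) le_rfl) ?_
    (integrable_exp_mul_restrict_Icc M' θ)
  exact Eventually.of_forall fun y => (Real.exp_pos _).le

/-- Change of measure at a critical point of the truncated moment generating function. -/
lemma eventually_le_pi_of_deriv_eq_zero {M θ δ : ℝ} (hδ : 0 < δ)
    (hpos : 0 < truncMgf μ M θ) (hderiv : deriv (truncMgf μ M) θ = 0) :
    ∀ᶠ m : ℕ in atTop,
      ENNReal.ofReal (2⁻¹ * (truncMgf μ M θ * Real.exp (-(|θ| * δ))) ^ m) ≤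
        Measure.pi (fun _ : Fin m => μ) {y | |∑ i, y i| ≤ m * δ} := by
  set κ := μ.restrict (Icc (-M) M) with hκ
  set Z := truncMgf μ M θ with hZ
  set g : ℝ → ENNReal :=
    (Icc (-M) M).indicator fun y => ENNReal.ofReal (Real.exp (θ * y) / Z) with hg
  have hgm : Measurable g :=
    (by fun_prop : Measurable fun y : ℝ => ENNReal.ofReal (Real.exp (θ * y) / Z)).indicator
      measurableSet_Icc
  have hρ : κ.tilted (θ * id ·) = μ.withDensity g := by
    rw [hg, withDensity_indicator measurableSet_Icc]; rfl
  have hprob : IsProbabilityMeasure (κ.tilted (θ * id ·)) := by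
    have : NeZero κ := ⟨fun h => by simp [hZ, truncMgf, ← hκ, h] at hpos⟩
    exact isProbabilityMeasure_tilted (integrable_exp_mul_restrict_Icc M θ)
  have hmean : ∫ y, y ∂(κ.tilted (θ * id ·)) = 0 := by
    -- The mean of a tilted law is the derivative of the cumulant generating function, that is `Z' /
    -- Z`, which vanishes at a critical point.
    have h1 := integral_tilted_mul_self
      (mem_interior_integrableExpSet_restrict_Icc (μ := μ) M θ)
    rw [deriv_cgf (mem_interior_integrableExpSet_restrict_Icc M θ),
      ← deriv_mgf (mem_interior_integrableExpSet_restrict_Icc M θ)] at h1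
    have h2 : deriv (mgf id κ) θ = 0 := hderiv
    rw [h2, zero_div] at h1
    exact h1
  have hmem : MemLp id 2 (κ.tilted (θ * id ·)) := by
    exact_mod_cast memLp_tilted_mul (mem_interior_integrableExpSet_restrict_Icc (μ := μ) M θ) 2
  filter_upwards [eventually_half_le_pi _ hmem hmean hδ] with m hm
  rw [hρ] at hprob
  simp only [hρ] at hm
  rw [pi_withDensity μ hgm] at hm
  set A : Set (Fin m → ℝ) := {y | |∑ i, y i| ≤ m * δ} with hA
  have hAm : MeasurableSet A := measurableSet_le (by fun_prop) (by fun_prop)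
  rw [withDensity_apply _ hAm] at hm
  -- The product density depends on `y` only through `∑ i, y i`, which is small on `A`; so undoing
  -- the tilt costs at most `exp (|θ| δ)` per coordinate.
  have hbound : ∀ y ∈ A, ∏ i, g (y i) ≤ ENNReal.ofReal ((Real.exp (|θ| * δ) / Z) ^ m) := by
    intro y hy
    calc ∏ i, g (y i) ≤ ∏ i, ENNReal.ofReal (Real.exp (θ * y i) / Z) :=
          Finset.prod_le_prod' fun i _ => indicator_le_self _ _ _
      _ = ENNReal.ofReal (∏ i, (Real.exp (θ * y i) / Z)) :=
          (ENNReal.ofReal_prod_of_nonneg fun i _ => by positivity).symm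
      _ ≤ _ := by
          refine ENNReal.ofReal_le_ofReal ?_
          rw [Finset.prod_div_distrib, ← Real.exp_sum, ← Finset.mul_sum, div_pow, ← Real.exp_nat_mul]
          simp only [Finset.prod_const, Finset.card_univ, Fintype.card_fin]
          refine div_le_div_of_nonneg_right (Real.exp_le_exp.2 ?_) (by positivity)
          calc θ * ∑ i, y i ≤ |θ| * |∑ i, y i| := by rw [← abs_mul]; exact le_abs_self _
            _ ≤ |θ| * (m * δ) := by gcongr; exact hy
            _ = m * (|θ| * δ) := by ring
  have h3 : (2 : ENNReal)⁻¹ ≤ ENNReal.ofReal ((Real.exp (|θ| * δ) / Z) ^ m) *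
      Measure.pi (fun _ : Fin m => μ) A := by
    refine hm.trans ((setLIntegral_mono' hAm hbound).trans ?_)
    rw [setLIntegral_const]
  have h4 : (Z * Real.exp (-(|θ| * δ))) ^ m * (Real.exp (|θ| * δ) / Z) ^ m = 1 := by
    rw [← mul_pow, Real.exp_neg]
    field_simp
    simp
  calc ENNReal.ofReal (2⁻¹ * (Z * Real.exp (-(|θ| * δ))) ^ m)
      = ENNReal.ofReal ((Z * Real.exp (-(|θ| * δ))) ^ m) * 2⁻¹ := by
        rw [mul_comm, ENNReal.ofReal_mul (by positivity), ENNReal.ofReal_inv_of_pos two_pos]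
        simp
    _ ≤ ENNReal.ofReal ((Z * Real.exp (-(|θ| * δ))) ^ m) *
        (ENNReal.ofReal ((Real.exp (|θ| * δ) / Z) ^ m) * Measure.pi (fun _ : Fin m => μ) A) := by
        gcongr
    _ = Measure.pi (fun _ : Fin m => μ) A := by
        rw [← mul_assoc, ← ENNReal.ofReal_mul (by positivity), h4, ENNReal.ofReal_one, one_mul]

/-- These intervals exhaust the half-line. Being bounded and away from `0`, they make truncated
moment generating functions grow as `|θ| → ∞`. -/
lemma exists_pos_measure_Icc_of_Ioi {μ : Measure ℝ} (h : μ (Ioi 0) ≠ 0) :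
    ∃ n : ℕ, μ (Icc (1 / ((n : ℝ) + 1)) n) ≠ 0 := by
  by_contra! hc
  refine h (measure_mono_null (fun y hy => ?_) (measure_iUnion_null hc))
  obtain ⟨n, hn⟩ := exists_nat_one_div_lt (mem_Ioi.1 hy)
  obtain ⟨k, hk⟩ := exists_nat_ge y
  refine mem_iUnion.2 ⟨max n k, ?_, hk.trans (by exact_mod_cast le_max_right n k)⟩
  refine le_trans ?_ hn.le
  gcongr
  exact le_max_left n k

/-- If some of the mass lies at a distance from `0`, the truncated moment generating function
grows exponentially. -/
lemma le_truncMgf {s : Set ℝ} (hs : MeasurableSet s) {M θ c : ℝ} (hsM : s ⊆ Icc (-M) M)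
    (hc : ∀ y ∈ s, c ≤ θ * y) : μ.real s * Real.exp c ≤ truncMgf μ M θ := by
  have h1 : ∫ y in s, Real.exp c ∂μ ≤ ∫ y in s, Real.exp (θ * y) ∂μ := by
    refine setIntegral_mono_on (by simp)
      ((show IntegrableOn _ _ μ from integrable_exp_mul_restrict_Icc M θ).mono_set hsM) hs
      fun y hy => Real.exp_le_exp.2 (hc y hy)
  rw [setIntegral_const, smul_eq_mul] at h1
  refine h1.trans ?_
  exact setIntegral_mono_set (integrable_exp_mul_restrict_Icc M θ)
    (Eventually.of_forall fun y => (Real.exp_pos _).le) hsM.eventuallyLE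

lemma truncMgf_zero_le (M : ℝ) : truncMgf μ M 0 ≤ 1 := by
  rw [truncMgf, mgf_zero']
  simp [measureReal_le_one]

/-- If the truncated moment generating functions at `θ` stay below `r`, then so does the full
one. -/
lemma mgf_le_of_truncMgf_le {θ r : ℝ} (hr : 0 ≤ r) (h : ∀ n : ℕ, truncMgf μ n θ ≤ r) :
    θ ∈ integrableExpSet id μ ∧ mgf id μ θ ≤ r := by
  have hlim : ∫⁻ y, ENNReal.ofReal (Real.exp (θ * y)) ∂μ ≤ ENNReal.ofReal r := by
    have hU : (⋃ n : ℕ, Icc (-(n : ℝ)) n) = univ := by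
      refine eq_univ_of_forall fun y => ?_
      obtain ⟨n, hn⟩ := exists_nat_ge |y|
      exact mem_iUnion.2 ⟨n, abs_le.1 hn⟩
    have hmono : Monotone fun n : ℕ => Icc (-(n : ℝ)) (n : ℝ) := fun a b hab =>
      Icc_subset_Icc (by simpa using hab) (by simpa using hab)
    rw [← setLIntegral_univ, ← hU, setLIntegral_iUnion_of_directed _ hmono.directed_le]
    refine iSup_le fun n => ?_
    change ∫⁻ y in _, ENNReal.ofReal (Real.exp (θ * id y)) ∂μ ≤ _
    rw [← ofReal_integral_eq_lintegral_ofReal (integrable_exp_mul_restrict_Icc n θ)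
      (Eventually.of_forall fun y => (Real.exp_pos _).le)]
    exact ENNReal.ofReal_le_ofReal (h n)
  have hint : Integrable (fun y : ℝ => Real.exp (θ * y)) μ := by
    refine ⟨by fun_prop, ?_⟩
    rw [hasFiniteIntegral_iff_ofReal (Eventually.of_forall fun y => (Real.exp_pos _).le)]
    exact hlim.trans_lt ENNReal.ofReal_lt_top
  refine ⟨hint, ?_⟩
  rw [← ofReal_integral_eq_lintegral_ofReal hint
    (Eventually.of_forall fun y => (Real.exp_pos _).le)] at hlim
  exact (ENNReal.ofReal_le_ofReal_iff hr).1 hlim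

/-- If the law charges both half-lines, the infimum of the moment generating function is almost
attained by critical points of truncated ones. -/
lemma exists_deriv_truncMgf_eq_zero (hpos : μ (Ioi 0) ≠ 0) (hneg : μ (Iio 0) ≠ 0) {r : ℝ}
    (hr : 0 ≤ r) (h : ∀ θ ∈ integrableExpSet id μ, r < mgf id μ θ) :
    ∃ M θ : ℝ, r < truncMgf μ M θ ∧ deriv (truncMgf μ M) θ = 0 := by
  obtain ⟨n₁, hn₁⟩ := exists_pos_measure_Icc_of_Ioi hpos
  have hneg' : (μ.map Neg.neg) (Ioi 0) ≠ 0 := by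
    rw [Measure.map_apply measurable_neg measurableSet_Ioi]
    simpa using hneg
  obtain ⟨n₂, hn₂⟩ := exists_pos_measure_Icc_of_Ioi hneg'
  rw [Measure.map_apply measurable_neg measurableSet_Icc] at hn₂
  set s₁ := Icc (1 / ((n₁ : ℝ) + 1)) n₁
  set s₂ := Neg.neg ⁻¹' Icc (1 / ((n₂ : ℝ) + 1)) (n₂ : ℝ) with hs₂
  have hp₁ : 0 < μ.real s₁ := ENNReal.toReal_pos hn₁ (measure_ne_top _ _)
  have hp₂ : 0 < μ.real s₂ := ENNReal.toReal_pos hn₂ (measure_ne_top _ _)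
  set N := max n₁ n₂
  have h1N : ∀ n : ℕ, N ≤ n → s₁ ⊆ Icc (-(n : ℝ)) n := fun n hn y hy => by
    have : (n₁ : ℝ) ≤ n := by exact_mod_cast (le_max_left n₁ n₂).trans hn
    have h0 : (0 : ℝ) ≤ 1 / ((n₁ : ℝ) + 1) := by positivity
    exact ⟨by linarith [hy.1, hy.2], hy.2.trans this⟩
  have h2N : ∀ n : ℕ, N ≤ n → s₂ ⊆ Icc (-(n : ℝ)) n := fun n hn y hy => by
    have : (n₂ : ℝ) ≤ n := by exact_mod_cast (le_max_right n₁ n₂).trans hn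
    have h0 : (0 : ℝ) ≤ 1 / ((n₂ : ℝ) + 1) := by positivity
    have h3 := hy.1
    have h4 := hy.2
    exact ⟨by linarith, by linarith⟩
  -- outside `[-R, R]` the truncated moment generating functions exceed `1`
  obtain ⟨R, hR0, hR⟩ : ∃ R : ℝ, 0 ≤ R ∧ ∀ n : ℕ, N ≤ n → ∀ θ ∉ Icc (-R) R,
      1 < truncMgf μ n θ := by
    have e₁ : Tendsto (fun R : ℝ => μ.real s₁ * Real.exp (R * (1 / ((n₁ : ℝ) + 1)))) atTop atTop :=
      (Real.tendsto_exp_atTop.comp (tendsto_id.atTop_mul_const (by positivity))).const_mul_atTop hp₁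
    have e₂ : Tendsto (fun R : ℝ => μ.real s₂ * Real.exp (R * (1 / ((n₂ : ℝ) + 1)))) atTop atTop :=
      (Real.tendsto_exp_atTop.comp (tendsto_id.atTop_mul_const (by positivity))).const_mul_atTop hp₂
    obtain ⟨R, hR₁, hR₂, hR0⟩ := ((e₁.eventually_gt_atTop 1).and
      ((e₂.eventually_gt_atTop 1).and (eventually_ge_atTop 0))).exists
    refine ⟨R, hR0, fun n hn θ hθ => ?_⟩
    rcases lt_or_ge R θ with h1 | h1
    · refine hR₁.trans_le (le_truncMgf measurableSet_Icc (h1N n hn) fun y hy => ?_)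
      exact mul_le_mul h1.le hy.1 (by positivity) (hR0.trans h1.le)
    · have h2 : θ < -R := by
        by_contra hc
        exact hθ ⟨not_lt.1 hc, h1⟩
      refine hR₂.trans_le (le_truncMgf (measurable_neg measurableSet_Icc) (h2N n hn) fun y hy => ?_)
      calc R * (1 / ((n₂ : ℝ) + 1)) ≤ (-θ) * (-y) :=
            mul_le_mul (by linarith) hy.1 (by positivity) (by linarith)
        _ = θ * y := by ring
  -- some truncated moment generating function exceeds `r` on `[-R, R]`
  obtain ⟨n, hnN, hn⟩ : ∃ n : ℕ, N ≤ n ∧ ∀ θ ∈ Icc (-R) R, r < truncMgf μ n θ := by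
    by_contra! hc
    have hne := IsCompact.nonempty_iInter_of_sequence_nonempty_isCompact_isClosed
      (fun n : ℕ => Icc (-R) R ∩ {θ | truncMgf μ (N + n : ℕ) θ ≤ r})
      (fun n θ hθ => ⟨hθ.1, (truncMgf_mono θ (by push_cast; linarith)).trans hθ.2⟩)
      (fun n => by
        obtain ⟨θ, h1, h2⟩ := hc (N + n) (Nat.le_add_right _ _)
        exact ⟨θ, h1, h2⟩)
      (isCompact_Icc.inter_right (isClosed_le (continuous_truncMgf _) continuous_const))
      (fun n => isClosed_Icc.inter (isClosed_le (continuous_truncMgf _) continuous_const))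
    obtain ⟨θ, hθ⟩ := hne
    rw [mem_iInter] at hθ
    obtain ⟨h1, h2⟩ := mgf_le_of_truncMgf_le hr fun n : ℕ =>
      (truncMgf_mono (μ := μ) θ (show (n : ℝ) ≤ (N + n : ℕ) by simp)).trans (hθ n).2
    exact (h θ h1).not_ge h2
  obtain ⟨θ, hθR, hθ⟩ := isCompact_Icc.exists_isMinOn (nonempty_Icc.2 (by linarith : -R ≤ R))
    (continuous_truncMgf (μ := μ) n).continuousOn
  refine ⟨n, θ, hn θ hθR, ?_⟩
  -- The minimiser on `[-R, R]` is global: the value at `0` is at most `1`, and outside the interval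
  -- the function exceeds `1`.
  have hmin : ∀ θ', truncMgf μ n θ ≤ truncMgf μ n θ' := by
    intro θ'
    by_cases hθ' : θ' ∈ Icc (-R) R
    · exact hθ hθ'
    · calc truncMgf μ n θ ≤ truncMgf μ n 0 := hθ (by simpa using hR0)
        _ ≤ 1 := truncMgf_zero_le _
        _ ≤ _ := (hR n hnN θ' hθ').le
  exact IsLocalMin.deriv_eq_zero (Eventually.of_forall hmin)

/-- If the law lives on one closed half-line, the infimum of the moment generating function is at
most the mass at `0`. -/
lemma le_measure_singleton_zero {s r : ℝ} (hs : s ≠ 0) (hμ : ∀ᵐ y ∂μ, s * y ≤ 0)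
    (h : ∀ θ ∈ integrableExpSet id μ, r ≤ mgf id μ θ) : r ≤ μ.real {0} := by
  -- Sending the parameter to infinity in the direction of `s` kills all mass except the atom at
  -- `0`; the integrands are dominated by `1`.
  have hlim : Tendsto (fun n : ℕ => ∫ y, Real.exp (n * s * y) ∂μ) atTop
      (𝓝 (∫ y, ({0} : Set ℝ).indicator (fun _ => (1 : ℝ)) y ∂μ)) := by
    refine tendsto_integral_of_dominated_convergence (fun _ => 1) (fun n => by fun_prop)
      (integrable_const _) (fun n => ?_) ?_
    · filter_upwards [hμ] with y hy
      rw [Real.norm_eq_abs, Real.abs_exp, Real.exp_le_one_iff, mul_assoc]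
      exact mul_nonpos_of_nonneg_of_nonpos n.cast_nonneg hy
    · filter_upwards [hμ] with y hy
      rcases eq_or_ne y 0 with rfl | hy0
      · simp
      · rw [indicator_of_notMem (by simpa using hy0)]
        have h1 : s * y < 0 := lt_of_le_of_ne hy (mul_ne_zero hs hy0)
        simp_rw [mul_assoc]
        exact Real.tendsto_exp_atBot.comp (tendsto_natCast_atTop_atTop.atTop_mul_const_of_neg h1)
  rw [integral_indicator_const _ (measurableSet_singleton 0), smul_eq_mul, mul_one] at hlim
  refine ge_of_tendsto' hlim fun n => h _ ?_
  refine (integrable_const (1 : ℝ)).mono' (by fun_prop) ?_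
  filter_upwards [hμ] with y hy
  rw [Real.norm_eq_abs, Real.abs_exp, Real.exp_le_one_iff, mul_assoc]
  exact mul_nonpos_of_nonneg_of_nonpos n.cast_nonneg hy

/-- The lower bound in Cramér's theorem at the point `0`. -/
theorem eventually_le_pi_abs_sum_le {L ε δ : ℝ}
    (h : ∀ θ ∈ integrableExpSet id μ, Real.exp (-L) ≤ mgf id μ θ) (hε : 0 < ε) (hδ : 0 < δ) :
    ∀ᶠ m : ℕ in atTop, ENNReal.ofReal (Real.exp (-(m * (L + ε)))) ≤
      Measure.pi (fun _ : Fin m => μ) {y | |∑ i, y i| ≤ m * δ} := by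
  -- With a large enough atom at `0`, the event that every summand is `0` already suffices.
  have hatom : Real.exp (-L) ≤ μ.real {0} →
      ∀ᶠ m : ℕ in atTop, ENNReal.ofReal (Real.exp (-(m * (L + ε)))) ≤
        Measure.pi (fun _ : Fin m => μ) {y | |∑ i, y i| ≤ m * δ} := by
    refine fun h0 => Eventually.of_forall fun m => ?_
    calc ENNReal.ofReal (Real.exp (-(m * (L + ε))))
        ≤ ENNReal.ofReal (μ.real {0} ^ m) := by
          refine ENNReal.ofReal_le_ofReal (le_trans ?_ (pow_le_pow_left₀ (Real.exp_pos _).le h0 m))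
          rw [← Real.exp_nat_mul]
          refine Real.exp_le_exp.2 ?_
          nlinarith [mul_nonneg (Nat.cast_nonneg (α := ℝ) m) hε.le]
      _ = Measure.pi (fun _ : Fin m => μ) (univ.pi fun _ => {0}) := by
          rw [Measure.pi_pi, ENNReal.ofReal_pow measureReal_nonneg, ofReal_measureReal]
          simp
      _ ≤ _ := by
          refine measure_mono fun y hy => ?_
          have hy' : ∀ i, y i = 0 := fun i => hy i (mem_univ i)
          simp only [mem_ofPred_eq, hy', Finset.sum_const_zero, abs_zero]
          positivity
  by_cases hpos : μ (Ioi 0) = 0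
  · refine hatom (le_measure_singleton_zero one_ne_zero ?_ h)
    filter_upwards [measure_eq_zero_iff_ae_notMem.1 hpos] with y hy
    simpa using hy
  by_cases hneg : μ (Iio 0) = 0
  · refine hatom (le_measure_singleton_zero (s := -1) (by norm_num) ?_ h)
    filter_upwards [measure_eq_zero_iff_ae_notMem.1 hneg] with y hy
    simpa using hy
  obtain ⟨M, θ, hr, hderiv⟩ := exists_deriv_truncMgf_eq_zero hpos hneg
    (r := Real.exp (-(L + ε / 4))) (Real.exp_pos _).le fun θ hθ =>
      lt_of_lt_of_le (Real.exp_lt_exp.2 (by linarith)) (h θ hθ)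
  -- The loss `ε` is split: `ε / 4` for near-minimality, `ε / 4` for undoing the tilt (hence the
  -- smaller `δ'`), and `ε / 2` for the factor `1 / 2` from Chebyshev.
  set δ' := min δ (ε / (4 * (|θ| + 1))) with hδ'
  have hδ'0 : 0 < δ' := lt_min hδ (by positivity)
  have hθδ : |θ| * δ' ≤ ε / 4 := by
    calc |θ| * δ' ≤ (|θ| + 1) * (ε / (4 * (|θ| + 1))) :=
          mul_le_mul (by linarith) (min_le_right _ _) hδ'0.le (by positivity)
      _ = ε / 4 := by field_simp
  have hlog : ∀ᶠ m : ℕ in atTop, Real.log 2 ≤ m * (ε / 2) :=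
    (tendsto_natCast_atTop_atTop.atTop_mul_const (by positivity)).eventually_ge_atTop _
  filter_upwards [eventually_le_pi_of_deriv_eq_zero hδ'0 ((Real.exp_pos _).trans hr) hderiv,
    hlog] with m hm hml
  refine le_trans (ENNReal.ofReal_le_ofReal ?_) (hm.trans (measure_mono fun y hy =>
    le_trans (mem_ofPred_eq ▸ hy) (by gcongr; exact min_le_left _ _)))
  calc Real.exp (-(m * (L + ε)))
      ≤ Real.exp (-Real.log 2 + m * (-(L + ε / 4) + -(|θ| * δ'))) := by
        refine Real.exp_le_exp.2 ?_
        nlinarith [mul_le_mul_of_nonneg_left hθδ (Nat.cast_nonneg (α := ℝ) m)]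
    _ = 2⁻¹ * (Real.exp (-(L + ε / 4)) * Real.exp (-(|θ| * δ'))) ^ m := by
        rw [Real.exp_add, Real.exp_neg, Real.exp_log two_pos, Real.exp_nat_mul, Real.exp_add]
    _ ≤ _ := by gcongr

end Cramer

/-! ### The arrival rate: nonnegativity and lower semicontinuity -/

lemma mulLogDiv_ne_bot (a b : ℝ) : mulLogDiv a b ≠ ⊥ := by
  unfold mulLogDiv
  split_ifs
  · simp
  · simp
  · exact EReal.coe_ne_bot _

lemma arrivalRate_ne_bot (t x : ℝ) : arrivalRate t x ≠ ⊥ :=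
  fun h => (EReal.add_eq_bot_iff.1 h).elim (mulLogDiv_ne_bot _ _) (mulLogDiv_ne_bot _ _)

/-- This is `1 - 1 / z ≤ log z` at `z = a / b`. In the sum of the two terms of the arrival rate the
linear bounds cancel, giving nonnegativity. -/
lemma sub_le_mulLogDiv {a b : ℝ} (ha : 0 ≤ a) (hb : 0 ≤ b) :
    ((a - b : ℝ) : EReal) ≤ mulLogDiv a b := by
  unfold mulLogDiv
  split_ifs with h1 h2
  · exact_mod_cast (by linarith : a - b ≤ 0)
  · exact le_top
  · have ha' : 0 < a := lt_of_le_of_ne ha (Ne.symm h1)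
    have hb' : 0 < b := lt_of_le_of_ne hb (Ne.symm h2)
    refine EReal.coe_le_coe_iff.2 ?_
    have h := Real.one_sub_inv_le_log_of_pos (div_pos ha' hb')
    calc a - b = a * (1 - (a / b)⁻¹) := by field_simp
      _ ≤ _ := by gcongr

lemma arrivalRate_nonneg {t x : ℝ} (ht : t ∈ Ioc (0 : ℝ) 1) (hx : x ∈ Icc (0 : ℝ) 1) :
    0 ≤ arrivalRate t x := by
  refine le_trans ?_ (add_le_add (sub_le_mulLogDiv ht.1.le hx.1)
    (sub_le_mulLogDiv (sub_nonneg.2 ht.2) (sub_nonneg.2 hx.2)))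
  rw [← EReal.coe_add]
  exact_mod_cast (by linarith : 0 ≤ t - x + (1 - t - (1 - x)))

/-- Cutting the denominator off at `c > 0` gives continuous functions of `b`; their supremum is
lower semicontinuous, including at `b = 0` where the value is `+∞`. -/
lemma mulLogDiv_eq_iSup {a b : ℝ} (ha : 0 < a) (hb : 0 ≤ b) :
    mulLogDiv a b = ⨆ c : Ioi (0 : ℝ), ((a * Real.log (a / max b c) : ℝ) : EReal) := by
  unfold mulLogDiv
  rw [if_neg ha.ne']
  split_ifs with h
  · subst h
    refine (iSup_eq_top.2 fun u hu => ?_).symm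
    induction u with
    | bot => exact ⟨⟨1, mem_Ioi.2 one_pos⟩, EReal.bot_lt_coe _⟩
    | top => exact absurd hu (lt_irrefl _)
    | coe u =>
      refine ⟨⟨a * Real.exp (-((u + 1) / a)), mem_Ioi.2 (by positivity)⟩, EReal.coe_lt_coe_iff.2 ?_⟩
      have : a / (a * Real.exp (-((u + 1) / a))) = Real.exp ((u + 1) / a) := by
        rw [Real.exp_neg]; field_simp
      rw [max_eq_right (by positivity), this, Real.log_exp, mul_div_cancel₀ _ ha.ne']
      linarith
  · have hb' : 0 < b := lt_of_le_of_ne hb (Ne.symm h)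
    refine le_antisymm (le_iSup_of_le ⟨b, hb'⟩ (by simp)) (iSup_le fun c => ?_)
    refine EReal.coe_le_coe_iff.2 (mul_le_mul_of_nonneg_left ?_ ha.le)
    exact Real.log_le_log (div_pos ha (lt_max_of_lt_left hb'))
      (div_le_div_of_nonneg_left ha.le hb' (le_max_left _ _))

lemma lowerSemicontinuousOn_mulLogDiv {a : ℝ} (ha : 0 ≤ a) :
    LowerSemicontinuousOn (mulLogDiv a) (Ici 0) := by
  rcases ha.eq_or_lt with rfl | ha
  · have : mulLogDiv 0 = fun _ => 0 := by ext; simp [mulLogDiv]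
    rw [this]
    exact lowerSemicontinuousOn_const
  · have h : LowerSemicontinuousOn
        (fun b : ℝ => ⨆ c : Ioi (0 : ℝ), ((a * Real.log (a / max b c) : ℝ) : EReal)) (Ici (0 : ℝ)) := by
      refine lowerSemicontinuousOn_iSup fun c => Continuous.lowerSemicontinuous ?_ |>.lowerSemicontinuousOn _
      have hc : ∀ b : ℝ, 0 < max b c := fun b => lt_max_of_lt_right c.2
      refine continuous_coe_real_ereal.comp (continuous_const.mul (Continuous.log ?_ fun b => ?_))
      · exact continuous_const.div (by fun_prop) fun b => (hc b).ne'
      · exact (div_pos ha (hc b)).ne'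
    intro x hx y hy
    have hx' := mulLogDiv_eq_iSup ha hx
    rw [hx'] at hy
    filter_upwards [h x hx y hy, self_mem_nhdsWithin] with z hz hz0
    rwa [mulLogDiv_eq_iSup ha hz0]

lemma lowerSemicontinuousOn_arrivalRate {t : ℝ} (ht : t ∈ Ioc (0 : ℝ) 1) :
    LowerSemicontinuousOn (arrivalRate t) (Icc 0 1) := by
  have h1 : LowerSemicontinuousOn (mulLogDiv t) (Icc 0 1) :=
    (lowerSemicontinuousOn_mulLogDiv ht.1.le).mono fun x hx => hx.1
  have h2 : LowerSemicontinuousOn (fun x => mulLogDiv (1 - t) (1 - x)) (Icc 0 1) :=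
    (lowerSemicontinuousOn_mulLogDiv (sub_nonneg.2 ht.2)).comp (by fun_prop)
      fun x hx => sub_nonneg.2 hx.2
  exact h1.add' h2 fun x _ => EReal.continuousAt_add (Or.inr (mulLogDiv_ne_bot _ _))
    (Or.inl (mulLogDiv_ne_bot _ _))

/-! ### The service rate, the joint rate and goodness -/

section Service

variable {Ω : Type*} [MeasurableSpace Ω] {P : Measure Ω} {V : Ω → ℝ}
  {t : ℝ}

lemma le_serviceRate {θ : ℝ} (hθ : θ ∈ integrableExpSet V P) (x : ℝ) :
    ((θ * x - t * cgf V P θ : ℝ) : EReal) ≤ serviceRate P V t x :=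
  le_iSup₂_of_le θ hθ le_rfl

lemma serviceRate_nonneg [IsProbabilityMeasure P] (x : ℝ) : 0 ≤ serviceRate P V t x := by
  refine le_trans ?_ (le_serviceRate (θ := 0) (by simp [integrableExpSet]) x)
  simp

lemma serviceRate_ne_bot [IsProbabilityMeasure P] (x : ℝ) : serviceRate P V t x ≠ ⊥ :=
  ne_bot_of_le_ne_bot EReal.zero_ne_bot (serviceRate_nonneg x)

lemma lowerSemicontinuous_serviceRate : LowerSemicontinuous (serviceRate P V t) := by
  refine lowerSemicontinuous_biSup fun θ _ => Continuous.lowerSemicontinuous ?_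
  exact continuous_coe_real_ereal.comp (by fun_prop)

/-- The set of pairs (arrival epoch, amount of service). -/
def pairDomain : Set (ℝ × ℝ) := Icc (0 : ℝ) 1 ×ˢ Ici (0 : ℝ)

/-- The joint rate function of arrival epoch and service. -/
def pairRate (P : Measure Ω) (V : Ω → ℝ) (t : ℝ) (x : ℝ × ℝ) : EReal :=
  arrivalRate t x.1 + serviceRate P V t x.2

lemma pairRate_nonneg [IsProbabilityMeasure P] (ht : t ∈ Ioc (0 : ℝ) 1) {x : ℝ × ℝ} (hx : x ∈ pairDomain) :
    0 ≤ pairRate P V t x :=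
  add_nonneg (arrivalRate_nonneg ht hx.1) (serviceRate_nonneg _)

lemma lowerSemicontinuousOn_pairRate [IsProbabilityMeasure P] (ht : t ∈ Ioc (0 : ℝ) 1) :
    LowerSemicontinuousOn (pairRate P V t) pairDomain := by
  have h1 : LowerSemicontinuousOn (fun x : ℝ × ℝ => arrivalRate t x.1) pairDomain :=
    (lowerSemicontinuousOn_arrivalRate ht).comp (by fun_prop) fun x hx => hx.1
  have h2 : LowerSemicontinuousOn (fun x : ℝ × ℝ => serviceRate P V t x.2) pairDomain :=
    (lowerSemicontinuous_serviceRate.comp continuous_snd).lowerSemicontinuousOn _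
  exact h1.add' h2 fun x _ => EReal.continuousAt_add (Or.inr (serviceRate_ne_bot _))
    (Or.inl (arrivalRate_ne_bot _ _))

lemma exists_pos_mem_integrableExpSet (h0 : (0 : ℝ) ∈ interior (integrableExpSet V P)) :
    ∃ θ ∈ integrableExpSet V P, 0 < θ := by
  have h1 : integrableExpSet V P ∈ 𝓝[>] (0 : ℝ) :=
    mem_nhdsWithin_of_mem_nhds (mem_interior_iff_mem_nhds.1 h0)
  exact ((eventually_mem_set.2 h1).and self_mem_nhdsWithin).exists

/-- A single `θ > 0` with finite cumulant generating function makes the rate grow linearly in the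
service, so the level set lies in `[0, 1] × [0, M]`. -/
lemma isCompact_pairRate_le [IsProbabilityMeasure P] (ht : t ∈ Ioc (0 : ℝ) 1)
    (h0 : (0 : ℝ) ∈ interior (integrableExpSet V P)) (α : ℝ) :
    IsCompact (pairDomain ∩ {x | pairRate P V t x ≤ α}) := by
  obtain ⟨θ, hθ, hθ0⟩ := exists_pos_mem_integrableExpSet h0
  set M := (α + t * cgf V P θ) / θ
  have hK : IsCompact (Icc (0 : ℝ) 1 ×ˢ Icc (0 : ℝ) M) := isCompact_Icc.prod isCompact_Icc
  have hsub : Icc (0 : ℝ) 1 ×ˢ Icc (0 : ℝ) M ⊆ pairDomain := fun x hx => ⟨hx.1, hx.2.1⟩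
  convert ((lowerSemicontinuousOn_pairRate (P := P) (V := V) ht).mono hsub).isCompact_inter_preimage_Iic
    hK (α : EReal) using 1
  ext x
  refine ⟨fun hx => ⟨⟨hx.1.1, hx.1.2, ?_⟩, hx.2⟩, fun hx => ⟨hsub hx.1, hx.2⟩⟩
  have h1 : ((θ * x.2 - t * cgf V P θ : ℝ) : EReal) ≤ α := by
    refine le_trans ?_ hx.2
    rw [← zero_add ((θ * x.2 - t * cgf V P θ : ℝ) : EReal)]
    exact add_le_add (arrivalRate_nonneg ht hx.1.1) (le_serviceRate hθ _)
  have h2 := EReal.coe_le_coe_iff.1 h1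
  rw [le_div_iff₀ hθ0]
  linarith

lemma offeredLoadRate_le {x : ℝ × ℝ} (hx : x ∈ pairDomain) :
    offeredLoadRate P V t (x.2 - x.1) ≤ pairRate P V t x :=
  iInf₂_le_of_le x ⟨hx, by ring⟩ le_rfl

/-- The infimum over a fibre is attained: the fibre meets the joint level sets at `α + 1 / (n + 1)`
in nested nonempty compacts. Level sets of the offered load rate are thus continuous images of
compact sets. -/
lemma offeredLoadRate_le_iff [IsProbabilityMeasure P] (ht : t ∈ Ioc (0 : ℝ) 1)
    (h0 : (0 : ℝ) ∈ interior (integrableExpSet V P)) {α : ℝ} {y : ℝ} :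
    offeredLoadRate P V t y ≤ α ↔
      ∃ x ∈ pairDomain, pairRate P V t x ≤ α ∧ x.2 - x.1 = y := by
  constructor
  · intro h
    have hclosed : IsClosed {x : ℝ × ℝ | x.2 - x.1 = y} :=
      isClosed_eq (by fun_prop) continuous_const
    have hcomp : ∀ n : ℕ, IsCompact ((pairDomain ∩ {x | pairRate P V t x ≤
        ((α + 1 / ((n : ℝ) + 1) : ℝ) : EReal)}) ∩ {x : ℝ × ℝ | x.2 - x.1 = y}) := fun n =>
      (isCompact_pairRate_le ht h0 _).inter_right hclosed
    obtain ⟨x, hx⟩ := IsCompact.nonempty_iInter_of_sequence_nonempty_isCompact_isClosed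
      (fun n : ℕ => (pairDomain ∩ {x | pairRate P V t x ≤
        ((α + 1 / ((n : ℝ) + 1) : ℝ) : EReal)}) ∩ {x : ℝ × ℝ | x.2 - x.1 = y})
      (fun n x hx => ⟨⟨hx.1.1, hx.1.2.trans (EReal.coe_le_coe_iff.2 (by
        push_cast; gcongr; linarith))⟩, hx.2⟩)
      (fun n => by
        have h1 : offeredLoadRate P V t y < ((α + 1 / ((n : ℝ) + 1) : ℝ) : EReal) :=
          h.trans_lt (EReal.coe_lt_coe_iff.2 (by
            have : (0 : ℝ) < 1 / ((n : ℝ) + 1) := by positivity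
            linarith))
        simp only [offeredLoadRate, iInf_lt_iff] at h1
        obtain ⟨x, hx, hlt⟩ := h1
        exact ⟨x, ⟨hx.1, hlt.le⟩, by
          have := hx.2
          simp only [mem_ofPred_eq]
          linarith⟩)
      (hcomp 0) (fun n => (hcomp n).isClosed)
    rw [mem_iInter] at hx
    refine ⟨x, (hx 0).1.1, ?_, (hx 0).2⟩
    have hlim : Tendsto (fun n : ℕ => ((α + 1 / ((n : ℝ) + 1) : ℝ) : EReal)) atTop (𝓝 α) := by
      refine (continuous_coe_real_ereal.tendsto α).comp ?_
      simpa using tendsto_const_nhds.add (tendsto_one_div_add_atTop_nhds_zero_nat (𝕜 := ℝ))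
    exact ge_of_tendsto' hlim fun n => (hx n).1.2
  · rintro ⟨x, hx, hle, rfl⟩
    exact (offeredLoadRate_le hx).trans hle

lemma isGoodRateFunction_offeredLoadRate [IsProbabilityMeasure P] (ht : t ∈ Ioc (0 : ℝ) 1)
    (h0 : (0 : ℝ) ∈ interior (integrableExpSet V P)) :
    IsGoodRateFunction (offeredLoadRate P V t) := by
  have hcomp : ∀ α : ℝ, IsCompact {y | offeredLoadRate P V t y ≤ (α : EReal)} := by
    intro α
    convert (isCompact_pairRate_le ht h0 α).image (f := fun x : ℝ × ℝ => x.2 - x.1)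
      (by fun_prop) using 1
    ext y
    rw [mem_ofPred_eq, offeredLoadRate_le_iff ht h0]
    simp only [mem_image, mem_inter_iff, mem_ofPred_eq, and_assoc]
  have hnn : ∀ y, 0 ≤ offeredLoadRate P V t y := fun y =>
    le_iInf₂ fun x hx => pairRate_nonneg ht hx.1
  refine ⟨hnn, lowerSemicontinuous_iff_isClosed_preimage.2 fun a => ?_, hcomp⟩
  induction a with
  | bot =>
    convert isClosed_empty
    refine eq_empty_of_forall_notMem fun y hy => ?_
    exact absurd ((hnn y).trans hy) (by simp)
  | top => convert isClosed_univ; simp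
  | coe α => exact (hcomp α).isClosed

end Service

/-! ### Order statistics of uniform samples -/

section OrderStatistics

variable {n k : ℕ}

lemma orderStat_eq (v : Fin n → ℝ) (hk : 1 ≤ k) (hkn : k ≤ n) :
    orderStat v k = v (Tuple.sort v ⟨k - 1, by omega⟩) := dif_pos ⟨hk, hkn⟩

/-- The indices of the `k` smallest entries separate the entries at the `k`-th order statistic. -/
lemma exists_card_eq_orderStat (v : Fin n → ℝ) (hk : 1 ≤ k) (hkn : k ≤ n) :
    ∃ A : Finset (Fin n), A.card = k ∧ (∀ i ∈ A, v i ≤ orderStat v k) ∧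
      ∀ i ∉ A, orderStat v k ≤ v i := by
  have hmono : ∀ {i j : Fin n}, i ≤ j → v (Tuple.sort v i) ≤ v (Tuple.sort v j) :=
    fun h => Tuple.monotone_sort v h
  refine ⟨(Finset.Iic (⟨k - 1, by omega⟩ : Fin n)).map (Tuple.sort v).toEmbedding, ?_, ?_, ?_⟩
  · rw [Finset.card_map, Fin.card_Iic]
    exact Nat.sub_add_cancel hk
  · intro i hi
    obtain ⟨j, hj, rfl⟩ := Finset.mem_map.1 hi
    rw [orderStat_eq v hk hkn]
    exact hmono (Finset.mem_Iic.1 hj)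
  · intro i hi
    obtain ⟨j, rfl⟩ := (Tuple.sort v).surjective i
    rw [orderStat_eq v hk hkn]
    refine hmono (le_of_not_ge fun h => hi ?_)
    exact Finset.mem_map.2 ⟨j, Finset.mem_Iic.2 h, rfl⟩

lemma orderStat_le {v : Fin n → ℝ} (hk : 1 ≤ k) (hkn : k ≤ n) {A : Finset (Fin n)} {c : ℝ}
    (hA : k ≤ A.card) (h : ∀ i ∈ A, v i ≤ c) : orderStat v k ≤ c := by
  by_contra! hlt
  rw [orderStat_eq v hk hkn] at hlt
  have hsub : A ⊆ (Finset.Iio (⟨k - 1, by omega⟩ : Fin n)).map (Tuple.sort v).toEmbedding := by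
    intro i hi
    obtain ⟨j, rfl⟩ := (Tuple.sort v).surjective i
    refine Finset.mem_map.2 ⟨j, Finset.mem_Iio.2 (lt_of_not_ge fun hj => ?_), rfl⟩
    exact ((Tuple.monotone_sort v hj).trans (h _ hi)).not_gt hlt
  have := Finset.card_le_card hsub
  rw [Finset.card_map, Fin.card_Iio] at this
  simp only at this
  omega

/-- This exhibits the event as a finite union of finite intersections of half-spaces, whence
measurability. -/
lemma orderStat_le_iff (v : Fin n → ℝ) (hk : 1 ≤ k) (hkn : k ≤ n) (c : ℝ) :
    orderStat v k ≤ c ↔ ∃ A ∈ Finset.powersetCard k (Finset.univ : Finset (Fin n)),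
      ∀ i ∈ A, v i ≤ c := by
  constructor
  · intro h
    obtain ⟨A, hA, hA1, -⟩ := exists_card_eq_orderStat v hk hkn
    exact ⟨A, by simpa using hA, fun i hi => (hA1 i hi).trans h⟩
  · rintro ⟨A, hA, h⟩
    exact orderStat_le hk hkn (Finset.mem_powersetCard.1 hA).2.ge h

lemma measurable_orderStat (k : ℕ) : Measurable fun v : Fin n → ℝ => orderStat v k := by
  by_cases h : 1 ≤ k ∧ k ≤ n
  · refine measurable_of_Iic fun c => ?_
    have : (fun v : Fin n → ℝ => orderStat v k) ⁻¹' Iic c =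
        ⋃ A ∈ Finset.powersetCard k (Finset.univ : Finset (Fin n)),
          ⋂ i ∈ A, {v : Fin n → ℝ | v i ≤ c} := by
      ext v
      simp only [mem_preimage, mem_Iic, orderStat_le_iff v h.1 h.2, mem_iUnion, mem_iInter,
        mem_ofPred_eq, exists_prop]
    rw [this]
    exact Finset.measurableSet_biUnion _ fun A _ => Finset.measurableSet_biInter _ fun i _ =>
      measurableSet_le (measurable_pi_apply i) measurable_const
  · have : (fun v : Fin n → ℝ => orderStat v k) = fun _ => 0 := by
      ext v; exact dif_neg h
    rw [this]
    exact measurable_const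

/-- If exactly `k` entries are at most `b`, and one of those is at least `a`, then the `k`-th order
statistic lies in `[a, b]`. -/
lemma orderStat_mem_Icc {v : Fin n → ℝ} (hk : 1 ≤ k) (hkn : k ≤ n) {A : Finset (Fin n)} {a b : ℝ}
    (hA : A.card = k) (h1 : ∀ i ∈ A, v i ≤ b) (h2 : ∀ i ∉ A, b < v i) (h3 : ∃ i ∈ A, a ≤ v i) :
    orderStat v k ∈ Icc a b := by
  have hb := orderStat_le hk hkn hA.ge h1
  refine ⟨?_, hb⟩
  obtain ⟨B, hB, hB1, hB2⟩ := exists_card_eq_orderStat v hk hkn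
  -- Entries outside `A` exceed `b`, so the `k` smallest entries lie in `A`, and the cardinalities
  -- agree.
  have hBA : B = A := by
    refine Finset.eq_of_subset_of_card_le (fun i hi => ?_) (hA.trans hB.symm).le
    by_contra hiA
    exact ((hB1 i hi).trans hb).not_gt (h2 i hiA)
  by_contra! hlt
  obtain ⟨i, hi, hai⟩ := h3
  exact ((hB1 i (hBA ▸ hi)).trans_lt hlt).not_ge hai

/-- The law of `n` independent uniform random variables on `[0, 1]`. -/
def uniformLaw (n : ℕ) : Measure (Fin n → ℝ) :=
  Measure.pi fun _ => (volume.restrict (Icc (0 : ℝ) 1) : Measure ℝ)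

lemma prod_ite_mem_eq {M : Type*} [CommMonoid M] (A : Finset (Fin n)) (x y : M) :
    ∏ i, (if i ∈ A then x else y) = x ^ A.card * y ^ (n - A.card) := by
  rw [Finset.prod_ite, Finset.prod_const, Finset.prod_const]
  congr 2
  · congr 1; ext; simp
  · rw [← Finset.compl_filter, Finset.card_compl, Fintype.card_fin]
    congr 2; ext; simp

lemma uniformLaw_pi_ite (A : Finset (Fin n)) (s s' : Set ℝ) :
    uniformLaw n (univ.pi fun i => if i ∈ A then s else s') =
      (volume.restrict (Icc (0 : ℝ) 1) s) ^ A.card *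
        (volume.restrict (Icc (0 : ℝ) 1) s') ^ (n - A.card) := by
  rw [uniformLaw, Measure.pi_pi, ← prod_ite_mem_eq]
  exact Finset.prod_congr rfl fun i _ => by split_ifs <;> rfl

/-- Union bound over the set `A` of the `k` smallest entries: those in `A` are at most `b`, the
others at least `a`. -/
lemma uniformLaw_orderStat_le (hk : 1 ≤ k) (hkn : k ≤ n) {a b : ℝ} (ha : a ≤ 1) (hb : 0 ≤ b) :
    uniformLaw n {v | orderStat v k ∈ Icc a b} ≤
      ENNReal.ofReal (n.choose k * (b ^ k * (1 - a) ^ (n - k))) := by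
  have hsub : {v : Fin n → ℝ | orderStat v k ∈ Icc a b} ⊆
      ⋃ A ∈ Finset.powersetCard k (Finset.univ : Finset (Fin n)),
        univ.pi fun i => if i ∈ A then Iic b else Ici a := by
    intro v hv
    obtain ⟨A, hA, hA1, hA2⟩ := exists_card_eq_orderStat v hk hkn
    refine mem_iUnion₂.2 ⟨A, by simpa using hA, fun i _ => ?_⟩
    by_cases hi : i ∈ A
    · simpa [hi] using (hA1 i hi).trans hv.2
    · simpa [hi] using hv.1.trans (hA2 i hi)
  have h1 : volume.restrict (Icc (0 : ℝ) 1) (Iic b) ≤ ENNReal.ofReal b := by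
    rw [Measure.restrict_apply measurableSet_Iic]
    exact (measure_mono (t := Icc 0 b) fun x hx => ⟨hx.2.1, hx.1⟩).trans (by simp)
  have h2 : volume.restrict (Icc (0 : ℝ) 1) (Ici a) ≤ ENNReal.ofReal (1 - a) := by
    rw [Measure.restrict_apply measurableSet_Ici]
    exact (measure_mono (t := Icc a 1) fun x hx => ⟨hx.1, hx.2.2⟩).trans (by simp)
  calc uniformLaw n {v | orderStat v k ∈ Icc a b}
      ≤ ∑ A ∈ Finset.powersetCard k (Finset.univ : Finset (Fin n)),
          uniformLaw n (univ.pi fun i => if i ∈ A then Iic b else Ici a) :=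
        (measure_mono hsub).trans (measure_biUnion_finset_le _ _)
    _ ≤ ∑ A ∈ Finset.powersetCard k (Finset.univ : Finset (Fin n)),
          ENNReal.ofReal (b ^ k * (1 - a) ^ (n - k)) := by
        refine Finset.sum_le_sum fun A hA => ?_
        rw [uniformLaw_pi_ite, (Finset.mem_powersetCard.1 hA).2, ENNReal.ofReal_mul (by positivity),
          ENNReal.ofReal_pow hb, ENNReal.ofReal_pow (by linarith)]
        gcongr
    _ = _ := by
        rw [Finset.sum_const, Finset.card_powersetCard, Finset.card_univ, Fintype.card_fin,
          nsmul_eq_mul, ENNReal.ofReal_mul (p := (n.choose k : ℝ)) (by positivity),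
          ENNReal.ofReal_natCast]

/-- Prescribing `A` as the exact set of entries at most `b` makes the events disjoint, so their
probabilities add up. Removing the box where all entries of `A` are below `a` produces `b ^ k - a ^
k`. -/
lemma le_uniformLaw_orderStat (hk : 1 ≤ k) (hkn : k ≤ n) {a b : ℝ} (ha : 0 ≤ a) (hab : a ≤ b)
    (hb : b ≤ 1) :
    ENNReal.ofReal (n.choose k * ((b ^ k - a ^ k) * (1 - b) ^ (n - k))) ≤
      uniformLaw n {v | orderStat v k ∈ Icc a b} := by
  set F : Finset (Fin n) → Set (Fin n → ℝ) := fun A =>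
    (univ.pi fun i => if i ∈ A then Iic b else Ioi b) \
      univ.pi fun i => if i ∈ A then Iio a else Ioi b with hF
  have hb0 : 0 ≤ b := ha.trans hab
  have hbox : ∀ (A : Finset (Fin n)) (s s' : Set ℝ), MeasurableSet s → MeasurableSet s' →
      MeasurableSet (univ.pi fun i => if i ∈ A then s else s') := fun A s s' hs hs' =>
    MeasurableSet.univ_pi fun i => by split_ifs <;> assumption
  have hle : ∀ {A v i}, v ∈ F A → i ∈ A → v i ≤ b := fun {A v i} hv hi => by
    simpa [hi] using hv.1 i (mem_univ i)
  have hgt : ∀ {A v i}, v ∈ F A → i ∉ A → b < v i := fun {A v i} hv hi => by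
    simpa [hi] using hv.1 i (mem_univ i)
  have hsub : (⋃ A ∈ Finset.powersetCard k (Finset.univ : Finset (Fin n)), F A) ⊆
      {v : Fin n → ℝ | orderStat v k ∈ Icc a b} := by
    refine iUnion₂_subset fun A hA v hv => ?_
    refine orderStat_mem_Icc hk hkn (Finset.mem_powersetCard.1 hA).2 (fun i hi => hle hv hi)
      (fun i hi => hgt hv hi) ?_
    by_contra! hc
    refine hv.2 fun i _ => ?_
    by_cases hi : i ∈ A
    · simpa [hi] using hc i hi
    · simpa [hi] using hgt hv hi
  have hdisj : (Finset.powersetCard k (Finset.univ : Finset (Fin n)) : Set _).PairwiseDisjoint F := by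
    intro A _ B _ hAB
    refine Set.disjoint_left.2 fun v hvA hvB => hAB ?_
    ext i
    constructor
    · intro hi
      by_contra hiB
      exact (hle hvA hi).not_gt (hgt hvB hiB)
    · intro hi
      by_contra hiA
      exact (hle hvB hi).not_gt (hgt hvA hiA)
  have hIic : volume.restrict (Icc (0 : ℝ) 1) (Iic b) = ENNReal.ofReal b := by
    rw [Measure.restrict_apply measurableSet_Iic]
    have : Iic b ∩ Icc 0 1 = Icc 0 b := by
      ext x; simp only [mem_inter_iff, mem_Iic, mem_Icc]; constructor <;> grind
    simp [this]
  have hIoi : volume.restrict (Icc (0 : ℝ) 1) (Ioi b) = ENNReal.ofReal (1 - b) := by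
    rw [Measure.restrict_apply measurableSet_Ioi]
    have : Ioi b ∩ Icc 0 1 = Ioc b 1 := by
      ext x; simp only [mem_inter_iff, mem_Ioi, mem_Icc, mem_Ioc]; constructor <;> grind
    simp [this]
  have hIio : volume.restrict (Icc (0 : ℝ) 1) (Iio a) = ENNReal.ofReal a := by
    rw [Measure.restrict_apply measurableSet_Iio]
    have : Iio a ∩ Icc 0 1 = Ico 0 a := by
      ext x; simp only [mem_inter_iff, mem_Iio, mem_Icc, mem_Ico]; constructor <;> grind
    simp [this]
  have hFA : ∀ A ∈ Finset.powersetCard k (Finset.univ : Finset (Fin n)),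
      ENNReal.ofReal ((b ^ k - a ^ k) * (1 - b) ^ (n - k)) ≤ uniformLaw n (F A) := by
    intro A hA
    refine le_trans (le_of_eq ?_) (le_measure_sdiff)
    rw [uniformLaw_pi_ite, uniformLaw_pi_ite, (Finset.mem_powersetCard.1 hA).2, hIic, hIoi, hIio,
      ← ENNReal.ofReal_pow (ha.trans hab), ← ENNReal.ofReal_pow ha,
      ← ENNReal.ofReal_pow (by linarith), ← ENNReal.ofReal_mul (by positivity),
      ← ENNReal.ofReal_mul (by positivity), ← ENNReal.ofReal_sub _
        (mul_nonneg (by positivity) (pow_nonneg (by linarith) _)), sub_mul]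
  calc ENNReal.ofReal (n.choose k * ((b ^ k - a ^ k) * (1 - b) ^ (n - k)))
      = ∑ A ∈ Finset.powersetCard k (Finset.univ : Finset (Fin n)),
          ENNReal.ofReal ((b ^ k - a ^ k) * (1 - b) ^ (n - k)) := by
        rw [Finset.sum_const, Finset.card_powersetCard, Finset.card_univ, Fintype.card_fin,
          nsmul_eq_mul, ENNReal.ofReal_mul (p := (n.choose k : ℝ)) (by positivity),
          ENNReal.ofReal_natCast]
    _ ≤ ∑ A ∈ Finset.powersetCard k (Finset.univ : Finset (Fin n)), uniformLaw n (F A) :=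
        Finset.sum_le_sum hFA
    _ = uniformLaw n (⋃ A ∈ Finset.powersetCard k (Finset.univ : Finset (Fin n)), F A) := by
        refine (measure_biUnion_finset hdisj fun A _ => ?_).symm
        exact (hbox A _ _ measurableSet_Iic measurableSet_Ioi).diff
          (hbox A _ _ measurableSet_Iio measurableSet_Ioi)
    _ ≤ _ := measure_mono hsub

end OrderStatistics

/-! ### Entropy bounds for binomial coefficients -/

section Binomial

/-- Up to the factor `n + 1`, the binomial weight at its mode carries the whole mass. -/
lemma pow_self_le_succ_mul_choose {n k : ℕ} (hkn : k ≤ n) :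
    n ^ n ≤ (n + 1) * (n.choose k * (k ^ k * (n - k) ^ (n - k))) := by
  set f : ℕ → ℕ := fun j => k ^ j * (n - k) ^ (n - j) * n.choose j with hf
  -- The ratio `f (j + 1) / f j = k (n - j) / ((n - k) (j + 1))`, in cross-multiplied form: it is at
  -- least `1` for `j < k` and at most `1` for `j ≥ k`, so `f` peaks at `k`.
  have hstep : ∀ j < n, f j * (j + 1) = k ^ j * (n - k) ^ (n - j - 1) * n.choose j *
      ((n - k) * (j + 1)) ∧
      f (j + 1) * (j + 1) = k ^ j * (n - k) ^ (n - j - 1) * n.choose j * (k * (n - j)) := by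
    intro j hj
    constructor
    · have : n - j = n - j - 1 + 1 := by omega
      simp only [hf]
      conv_lhs => rw [this, pow_succ]
      ring
    · have h1 := Nat.choose_succ_right_eq n j
      simp only [hf]
      calc k ^ (j + 1) * (n - k) ^ (n - (j + 1)) * n.choose (j + 1) * (j + 1)
          = k ^ (j + 1) * (n - k) ^ (n - (j + 1)) * (n.choose (j + 1) * (j + 1)) := by ring
        _ = _ := by rw [h1, Nat.sub_sub]; ring
  have hup : ∀ j < k, f j ≤ f (j + 1) := by
    intro j hj
    obtain ⟨h1, h2⟩ := hstep j (hj.trans_le hkn)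
    refine Nat.le_of_mul_le_mul_right ?_ (Nat.succ_pos j)
    rw [Nat.succ_eq_add_one, h1, h2]
    refine Nat.mul_le_mul_left _ ?_
    rw [mul_comm k]
    exact Nat.mul_le_mul (by omega) hj
  have hdown : ∀ j, k ≤ j → j < n → f (j + 1) ≤ f j := by
    intro j hkj hj
    obtain ⟨h1, h2⟩ := hstep j hj
    refine Nat.le_of_mul_le_mul_right ?_ (Nat.succ_pos j)
    rw [Nat.succ_eq_add_one, h1, h2]
    refine Nat.mul_le_mul_left _ ?_
    rw [mul_comm k]
    exact Nat.mul_le_mul (by omega) (by omega)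
  have hmax : ∀ j ≤ n, f j ≤ f k := by
    intro j hj
    rcases le_total j k with h | h
    · have : ∀ d ≤ k, f (k - d) ≤ f k := by
        intro d
        induction d with
        | zero => simp
        | succ d ih =>
          intro hd
          have h1 := hup (k - (d + 1)) (by omega)
          rw [show k - (d + 1) + 1 = k - d by omega] at h1
          exact h1.trans (ih (by omega))
      have h2 := this (k - j) (Nat.sub_le _ _)
      rwa [Nat.sub_sub_self h] at h2
    · induction j, h using Nat.le_induction with
      | base => exact le_rfl
      | succ j hkj ih => exact (hdown j hkj (by omega)).trans (ih (by omega))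
  calc n ^ n = (k + (n - k)) ^ n := by rw [Nat.add_sub_cancel' hkn]
    _ = ∑ j ∈ Finset.range (n + 1), f j := by rw [add_pow]; simp [hf]
    _ ≤ ∑ j ∈ Finset.range (n + 1), f k :=
        Finset.sum_le_sum fun j hj => hmax j (Nat.lt_succ_iff.1 (Finset.mem_range.1 hj))
    _ = _ := by simp [hf]; ring

lemma natCast_pow_self (k : ℕ) : (k : ℝ) ^ k = Real.exp (k * Real.log k) := by
  rcases Nat.eq_zero_or_pos k with rfl | h
  · simp
  · rw [Real.exp_nat_mul, Real.exp_log (by exact_mod_cast h)]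

lemma mul_binEntropy_div {n k : ℕ} (hn : 0 < n) (hkn : k ≤ n) :
    n * Real.binEntropy (k / n) =
      n * Real.log n - k * Real.log k - (n - k : ℕ) * Real.log (n - k : ℕ) := by
  have hn' : (n : ℝ) ≠ 0 := by positivity
  have h : ∀ x : ℝ, n * (x / n * Real.log (x / n)⁻¹) = x * Real.log n - x * Real.log x := by
    intro x
    rcases eq_or_ne x 0 with rfl | hx
    · simp
    · rw [inv_div, Real.log_div hn' hx]
      field_simp
  have h1 : 1 - (k : ℝ) / n = ((n - k : ℕ) : ℝ) / n := by
    rw [Nat.cast_sub hkn]; field_simp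
  rw [Real.binEntropy, mul_add, h1, h, h, Nat.cast_sub hkn]
  ring

lemma exp_binEntropy_le_choose {n k : ℕ} (hn : 0 < n) (hkn : k ≤ n) :
    Real.exp (n * Real.binEntropy (k / n)) ≤ (n + 1) * n.choose k := by
  have h : ((n ^ n : ℕ) : ℝ) ≤ (((n + 1) * (n.choose k * (k ^ k * (n - k) ^ (n - k))) : ℕ) : ℝ) :=
    Nat.cast_le.2 (pow_self_le_succ_mul_choose hkn)
  push_cast [natCast_pow_self] at h
  rw [mul_binEntropy_div hn hkn, Real.exp_sub, Real.exp_sub, div_div, div_le_iff₀ (by positivity)]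
  linarith

lemma choose_mul_pow_mul_pow_le_one {n k : ℕ} (hkn : k ≤ n) {t : ℝ} (ht : t ∈ Icc (0 : ℝ) 1) :
    n.choose k * (t ^ k * (1 - t) ^ (n - k)) ≤ 1 := by
  have h := add_pow t (1 - t) n
  rw [add_sub_cancel, one_pow] at h
  have h1 : ∀ j ∈ Finset.range (n + 1), 0 ≤ t ^ j * (1 - t) ^ (n - j) * n.choose j := fun j _ =>
    mul_nonneg (mul_nonneg (pow_nonneg ht.1 _) (pow_nonneg (sub_nonneg.2 ht.2) _)) (by positivity)
  refine le_trans (le_of_eq ?_)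
    ((Finset.single_le_sum h1 (Finset.mem_range.2 (Nat.lt_succ_iff.2 hkn))).trans h.ge)
  ring

/-- Replacing `b` by `a` in the power gains `exp (-k log (a / b))`; since `k` is within `1` of `n *
a`, rounding costs only a constant. For `a = 0` the exponent must be exactly `0`. -/
lemma exists_pow_le_of_le_mulLogDiv {a b u : ℝ} (ha : 0 ≤ a) (hb : 0 < b)
    (hu : (u : EReal) ≤ mulLogDiv a b) :
    ∃ C : ℝ, 0 < C ∧ ∀ n k : ℕ, |(k : ℝ) - n * a| ≤ 1 → (a = 0 → k = 0) →
      b ^ k ≤ C * Real.exp (-(n * u)) * a ^ k := by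
  unfold mulLogDiv at hu
  rcases ha.eq_or_lt with rfl | ha
  · refine ⟨1, one_pos, fun n k _ hk => ?_⟩
    rw [if_pos rfl] at hu
    have hu' : u ≤ 0 := by exact_mod_cast hu
    rw [hk rfl]
    simp only [pow_zero, one_mul, mul_one]
    refine Real.one_le_exp ?_
    nlinarith [Nat.cast_nonneg (α := ℝ) n]
  · rw [if_neg ha.ne', if_neg hb.ne', EReal.coe_le_coe_iff] at hu
    refine ⟨Real.exp |Real.log (a / b)|, Real.exp_pos _, fun n k hk _ => ?_⟩
    have h1 : b ^ k = Real.exp (-(k * Real.log (a / b))) * a ^ k := by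
      rw [← mul_neg, ← Real.log_inv, Real.exp_nat_mul, Real.exp_log (by positivity), ← mul_pow]
      congr 1
      field_simp
    rw [h1, ← Real.exp_add]
    refine mul_le_mul_of_nonneg_right (Real.exp_le_exp.2 ?_) (by positivity)
    have h2 : -(((k : ℝ) - n * a) * Real.log (a / b)) ≤ |Real.log (a / b)| := by
      refine (neg_le_abs _).trans ?_
      rw [abs_mul]
      exact mul_le_of_le_one_left (abs_nonneg _) hk
    nlinarith [mul_le_mul_of_nonneg_left hu (Nat.cast_nonneg (α := ℝ) n)]

end Binomial

/-! ### Rounding of `n * t` -/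

section Floor

variable {t : ℝ}

lemma floor_mul_le (ht : t ∈ Ioc (0 : ℝ) 1) (n : ℕ) : ⌊(n : ℝ) * t⌋₊ ≤ n :=
  Nat.floor_le_of_le (mul_le_of_le_one_right n.cast_nonneg ht.2)

lemma abs_floor_mul_sub_le (ht : t ∈ Ioc (0 : ℝ) 1) (n : ℕ) :
    |(⌊(n : ℝ) * t⌋₊ : ℝ) - n * t| ≤ 1 := by
  have h1 := Nat.floor_le (mul_nonneg n.cast_nonneg ht.1.le)
  have h2 := Nat.lt_floor_add_one ((n : ℝ) * t)
  rw [abs_le]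
  constructor <;> linarith

lemma abs_sub_floor_mul_sub_le (ht : t ∈ Ioc (0 : ℝ) 1) (n : ℕ) :
    |((n - ⌊(n : ℝ) * t⌋₊ : ℕ) : ℝ) - n * (1 - t)| ≤ 1 := by
  rw [Nat.cast_sub (floor_mul_le ht n), abs_sub_comm]
  convert abs_floor_mul_sub_le ht n using 2
  ring

lemma sub_floor_mul_eq_zero (ht : 1 - t = 0) (n : ℕ) : n - ⌊(n : ℝ) * t⌋₊ = 0 := by
  have : t = 1 := by linarith
  simp [this]

lemma tendsto_floor_mul_div (ht : t ∈ Ioc (0 : ℝ) 1) :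
    Tendsto (fun n : ℕ => (⌊(n : ℝ) * t⌋₊ : ℝ) / n) atTop (𝓝 t) := by
  simpa [mul_comm, Function.comp_def] using
    (tendsto_nat_floor_mul_div_atTop ht.1.le).comp tendsto_natCast_atTop_atTop

lemma tendsto_floor_mul (ht : t ∈ Ioc (0 : ℝ) 1) :
    Tendsto (fun n : ℕ => ⌊(n : ℝ) * t⌋₊) atTop atTop :=
  tendsto_nat_floor_atTop.comp (tendsto_natCast_atTop_atTop.atTop_mul_const ht.1)

end Floor

/-! ### From exponential estimates to normalised logarithmic limits -/

section Limits

variable {p : ℕ → ENNReal}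

lemma limsup_le_of_eventually_le {C α : ℝ} (hC : 0 < C)
    (h : ∀ᶠ n : ℕ in atTop, p n ≤ ENNReal.ofReal (C * Real.exp (-(n * α)))) :
    limsup (fun n : ℕ => ((1 / (n : ℝ) : ℝ) : EReal) * ENNReal.log (p n)) atTop ≤
      ((-α : ℝ) : EReal) := by
  refine EReal.le_of_forall_lt_iff_le.1 fun z hz => limsup_le_of_le (by isBoundedDefault) ?_
  have hz' : 0 < z + α := by linarith [EReal.coe_lt_coe_iff.1 hz]
  have hlog : ∀ᶠ n : ℕ in atTop, Real.log C ≤ n * (z + α) :=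
    (tendsto_natCast_atTop_atTop.atTop_mul_const hz').eventually_ge_atTop _
  filter_upwards [h, hlog, eventually_gt_atTop 0] with n hn hnl hn0
  have hn0' : (0 : ℝ) < n := by exact_mod_cast hn0
  have h1 : p n ≤ ENNReal.ofReal (Real.exp (n * z)) := by
    refine hn.trans (ENNReal.ofReal_le_ofReal ?_)
    rw [← Real.exp_log hC, ← Real.exp_add]
    exact Real.exp_le_exp.2 (by linarith)
  have h2 : ENNReal.log (p n) ≤ ((n * z : ℝ) : EReal) := by
    refine (ENNReal.log_monotone h1).trans ?_
    rw [ENNReal.log_ofReal_of_pos (Real.exp_pos _), Real.log_exp]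
  calc ((1 / (n : ℝ) : ℝ) : EReal) * ENNReal.log (p n)
      ≤ ((1 / (n : ℝ) : ℝ) : EReal) * ((n * z : ℝ) : EReal) :=
        mul_le_mul_of_nonneg_left h2 (by exact_mod_cast (by positivity))
    _ = z := by
        rw [← EReal.coe_mul]
        congr 1
        field_simp

lemma le_liminf_of_eventually_le {L : ℝ}
    (h : ∀ ε > 0, ∀ᶠ n : ℕ in atTop, ENNReal.ofReal (Real.exp (-(n * (L + ε)))) ≤ p n) :
    ((-L : ℝ) : EReal) ≤
      liminf (fun n : ℕ => ((1 / (n : ℝ) : ℝ) : EReal) * ENNReal.log (p n)) atTop := by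
  refine EReal.ge_of_forall_gt_iff_ge.1 fun z hz => le_liminf_of_le (by isBoundedDefault) ?_
  have hz' : 0 < -L - z := by linarith [EReal.coe_lt_coe_iff.1 hz]
  filter_upwards [h _ hz', eventually_gt_atTop 0] with n hn hn0
  have hn0' : (0 : ℝ) < n := by exact_mod_cast hn0
  have h2 : ((n * z : ℝ) : EReal) ≤ ENNReal.log (p n) := by
    refine le_trans (le_of_eq ?_) (ENNReal.log_monotone hn)
    rw [ENNReal.log_ofReal_of_pos (Real.exp_pos _), Real.log_exp]
    congr 1
    ring
  calc (z : EReal) = ((1 / (n : ℝ) : ℝ) : EReal) * ((n * z : ℝ) : EReal) := by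
        rw [← EReal.coe_mul]
        congr 1
        field_simp
    _ ≤ ((1 / (n : ℝ) : ℝ) : EReal) * ENNReal.log (p n) :=
        mul_le_mul_of_nonneg_left h2 (by exact_mod_cast (by positivity))

end Limits

/-! ### Exponential estimates for the arrival epoch -/

section Arrivals

variable {t : ℝ}

/-- After trading `b` for `t` and `1 - a` for `1 - t`, what remains is a single binomial probability
with parameter `t`, at most `1`. -/
lemma exists_eventually_uniformLaw_orderStat_le (ht : t ∈ Ioc (0 : ℝ) 1) {a b u v : ℝ}
    (ha : a < 1) (hb : 0 < b) (hu : (u : EReal) ≤ mulLogDiv t b)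
    (hv : (v : EReal) ≤ mulLogDiv (1 - t) (1 - a)) :
    ∃ C : ℝ, 0 < C ∧ ∀ᶠ n : ℕ in atTop,
      uniformLaw n {w | orderStat w ⌊(n : ℝ) * t⌋₊ ∈ Icc a b} ≤
        ENNReal.ofReal (C * Real.exp (-(n * (u + v)))) := by
  obtain ⟨C₁, hC₁, h₁⟩ := exists_pow_le_of_le_mulLogDiv ht.1.le hb hu
  obtain ⟨C₂, hC₂, h₂⟩ := exists_pow_le_of_le_mulLogDiv (sub_nonneg.2 ht.2) (sub_pos.2 ha) hv
  refine ⟨C₁ * C₂, by positivity, ?_⟩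
  filter_upwards [(tendsto_floor_mul ht).eventually_ge_atTop 1] with n hn
  refine (uniformLaw_orderStat_le hn (floor_mul_le ht n) ha.le hb.le).trans
    (ENNReal.ofReal_le_ofReal ?_)
  have h₁' := h₁ n _ (abs_floor_mul_sub_le ht n) fun h => absurd h ht.1.ne'
  have h₂' := h₂ n _ (abs_sub_floor_mul_sub_le ht n) fun h => sub_floor_mul_eq_zero h n
  have h₃ := choose_mul_pow_mul_pow_le_one (floor_mul_le ht n) ⟨ht.1.le, ht.2⟩
  have ha' : 0 ≤ 1 - a := (sub_pos.2 ha).le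
  have ht0 := ht.1.le
  set k := ⌊(n : ℝ) * t⌋₊
  calc (n.choose k : ℝ) * (b ^ k * (1 - a) ^ (n - k))
      ≤ n.choose k * ((C₁ * Real.exp (-(n * u)) * t ^ k) *
          (C₂ * Real.exp (-(n * v)) * (1 - t) ^ (n - k))) := by gcongr
    _ = C₁ * C₂ * Real.exp (-(n * (u + v))) * (n.choose k * (t ^ k * (1 - t) ^ (n - k))) := by
        rw [mul_add, neg_add, Real.exp_add]; ring
    _ ≤ C₁ * C₂ * Real.exp (-(n * (u + v))) * 1 := by gcongr
    _ = _ := mul_one _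

/-- The entropy form matches the exponent of the binomial estimate. For `t = 1` the point `x = 1` is
allowed: the vanishing factor `1 - t` hides `Real.log 0`. -/
lemma arrivalRate_of_ne_top {x : ℝ} (ht : t ∈ Ioc (0 : ℝ) 1) (hx : x ∈ Icc (0 : ℝ) 1)
    (h : arrivalRate t x ≠ ⊤) :
    0 < x ∧ (1 - t = 0 ∨ 0 < 1 - x) ∧ arrivalRate t x =
      ((-(Real.binEntropy t + t * Real.log x + (1 - t) * Real.log (1 - x)) : ℝ) : EReal) := by
  have h1 : mulLogDiv t x ≠ ⊤ := fun h' => h (by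
    rw [arrivalRate, h', EReal.top_add_of_ne_bot (mulLogDiv_ne_bot _ _)])
  have h2 : mulLogDiv (1 - t) (1 - x) ≠ ⊤ := fun h' => h (by
    rw [arrivalRate, h', EReal.add_top_of_ne_bot (mulLogDiv_ne_bot _ _)])
  have hx0 : 0 < x := by
    refine lt_of_le_of_ne hx.1 fun h0 => h1 ?_
    simp [mulLogDiv, ht.1.ne', ← h0]
  have h3 : 1 - t = 0 ∨ 0 < 1 - x := by
    by_contra! hc
    have : 1 - x = 0 := le_antisymm hc.2 (sub_nonneg.2 hx.2)
    exact h2 (by simp [mulLogDiv, hc.1, this])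
  refine ⟨hx0, h3, ?_⟩
  have e1 : mulLogDiv t x = ((-(t * Real.log t⁻¹ + t * Real.log x) : ℝ) : EReal) := by
    rw [mulLogDiv, if_neg ht.1.ne', if_neg hx0.ne', Real.log_div ht.1.ne' hx0.ne', Real.log_inv]
    congr 1; ring
  have e2 : mulLogDiv (1 - t) (1 - x) =
      ((-((1 - t) * Real.log (1 - t)⁻¹ + (1 - t) * Real.log (1 - x)) : ℝ) : EReal) := by
    rw [mulLogDiv]
    split_ifs with h4 h5
    · simp [h4]
    · rcases h3 with h3 | h3
      · exact absurd h3 h4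
      · exact absurd h5 h3.ne'
    · rw [Real.log_div h4 h5, Real.log_inv]
      congr 1; ring
  rw [arrivalRate, e1, e2, ← EReal.coe_add, Real.binEntropy]
  congr 1; ring

/-- The right endpoint is `x` itself, so the exponent converges to the rate at `x` by continuity in
`k / n` alone; no continuity of the rate in `x` is needed. -/
lemma eventually_le_uniformLaw_orderStat (ht : t ∈ Ioc (0 : ℝ) 1) {a x I ε : ℝ}
    (ha : 0 ≤ a) (hax : a < x) (hx : x ∈ Icc (0 : ℝ) 1) (hI : arrivalRate t x = I) (hε : 0 < ε) :
    ∀ᶠ n : ℕ in atTop, ENNReal.ofReal (Real.exp (-(n * (I + ε)))) ≤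
      uniformLaw n {w | orderStat w ⌊(n : ℝ) * t⌋₊ ∈ Icc a x} := by
  obtain ⟨hx0, hx1, hI'⟩ := arrivalRate_of_ne_top ht hx (by rw [hI]; exact EReal.coe_ne_top _)
  rw [hI, EReal.coe_eq_coe_iff] at hI'
  set g : ℝ → ℝ := fun p => Real.binEntropy p + p * Real.log x + (1 - p) * Real.log (1 - x)
  have hg : Tendsto (fun n : ℕ => g ((⌊(n : ℝ) * t⌋₊ : ℝ) / n)) atTop (𝓝 (-I)) := by
    have hc : Continuous g := by fun_prop
    have := (hc.tendsto t).comp (tendsto_floor_mul_div ht)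
    rwa [show g t = -I by rw [hI', neg_neg]] at this
  -- For `k ≥ 1`, `x ^ k - a ^ k ≥ c * x ^ k`, so removing `a ^ k` costs only a constant factor.
  set c := 1 - a / x
  have hc : 0 < c := sub_pos.2 ((div_lt_one hx0).2 hax)
  have hpoly : ∀ᶠ n : ℕ in atTop, (n + 1 : ℝ) ≤ c * Real.exp (n * (ε / 2)) := by
    have h1 : Tendsto (fun y : ℝ => Real.exp (ε / 2 * y) / y ^ 1) atTop atTop := by
      have := tendsto_exp_mul_div_rpow_atTop 1 (ε / 2) (by positivity)
      simpa using this
    filter_upwards [(h1.comp tendsto_natCast_atTop_atTop).eventually_ge_atTop (2 / c),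
      eventually_ge_atTop 1] with n hn hn1
    have hn1' : (1 : ℝ) ≤ n := by exact_mod_cast hn1
    simp only [Function.comp_apply, pow_one] at hn
    rw [div_le_div_iff₀ hc (by linarith)] at hn
    rw [mul_comm (n : ℝ)]
    linarith
  filter_upwards [hg.eventually_const_lt (show -I - ε / 2 < -I by linarith), hpoly,
    (tendsto_floor_mul ht).eventually_ge_atTop 1, eventually_gt_atTop 0] with n hgn hpn hk hn0
  refine le_trans (ENNReal.ofReal_le_ofReal ?_)
    (le_uniformLaw_orderStat hk (floor_mul_le ht n) ha hax.le hx.2)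
  have hkn := floor_mul_le ht n
  have hk0 : 1 - t = 0 → n - ⌊(n : ℝ) * t⌋₊ = 0 := fun h => sub_floor_mul_eq_zero h n
  set k := ⌊(n : ℝ) * t⌋₊
  have hn0' : (0 : ℝ) < n := by exact_mod_cast hn0
  have h1 : (1 - x) ^ (n - k) = Real.exp ((n - k : ℕ) * Real.log (1 - x)) := by
    rcases hx1 with h | h
    · simp [hk0 h]
    · rw [Real.exp_nat_mul, Real.exp_log h]
  have h2 : x ^ k = Real.exp (k * Real.log x) := by rw [Real.exp_nat_mul, Real.exp_log hx0]
  have h3 : c * x ^ k ≤ x ^ k - a ^ k := by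
    have h4 : (a / x) ^ k ≤ a / x :=
      pow_le_of_le_one (by positivity) ((div_le_one hx0).2 hax.le) (by omega)
    have h5 : a ^ k = (a / x) ^ k * x ^ k := by rw [← mul_pow, div_mul_cancel₀ _ hx0.ne']
    rw [h5]
    nlinarith [mul_le_mul_of_nonneg_right h4 (pow_pos hx0 k).le]
  have h6 : n * g (k / n) = n * Real.binEntropy (k / n) + k * Real.log x +
      (n - k : ℕ) * Real.log (1 - x) := by
    simp only [g]
    rw [Nat.cast_sub hkn]
    field_simp
  have h7 := exp_binEntropy_le_choose hn0 hkn
  have h8 : (n + 1) * Real.exp (-(n * (I + ε))) ≤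
      (n + 1) * (n.choose k * ((x ^ k - a ^ k) * (1 - x) ^ (n - k))) := by
    calc (n + 1) * Real.exp (-(n * (I + ε)))
        ≤ c * Real.exp (n * (ε / 2)) * Real.exp (-(n * (I + ε))) := by gcongr
      _ = c * Real.exp (n * (-I - ε / 2)) := by
          rw [mul_assoc, ← Real.exp_add]; congr 2; ring
      _ ≤ c * Real.exp (n * g (k / n)) := by gcongr
      _ = Real.exp (n * Real.binEntropy (k / n)) * ((c * x ^ k) * (1 - x) ^ (n - k)) := by
          rw [h6, Real.exp_add, Real.exp_add, h1, h2]; ring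
      _ ≤ ((n + 1) * n.choose k) * ((x ^ k - a ^ k) * (1 - x) ^ (n - k)) := by
          have : 0 ≤ (1 - x) ^ (n - k) := pow_nonneg (sub_nonneg.2 hx.2) _
          gcongr
      _ = _ := by ring
  exact le_of_mul_le_mul_left h8 (by positivity)

end Arrivals

/-! ### Exponential estimates for the service process -/

section Services

variable {Ω : Type*} [MeasurableSpace Ω] {P : Measure Ω} [IsProbabilityMeasure P]
  {ν : ℕ → Ω → ℝ} {t : ℝ}

lemma exists_measure_serviceProcess_le (hν_meas : ∀ i, Measurable (ν i)) (hν_indep : iIndepFun ν P)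
    (hν_ident : ∀ i, IdentDistrib (ν i) (ν 0) P P) (ht : t ∈ Ioc (0 : ℝ) 1) {θ : ℝ}
    (hθ : θ ∈ integrableExpSet (ν 0) P) (w : ℝ) :
    ∃ C : ℝ, 0 < C ∧ ∀ᶠ n : ℕ in atTop,
      P {ω | w + t * cgf (ν 0) P θ ≤ θ * serviceProcess ν n t ω} ≤
        ENNReal.ofReal (C * Real.exp (-(n * w))) := by
  set φ := cgf (ν 0) P θ with hφ
  refine ⟨Real.exp |φ|, Real.exp_pos _, ?_⟩
  filter_upwards [eventually_gt_atTop 0] with n hn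
  have hn0 : (0 : ℝ) < n := by exact_mod_cast hn
  set k := ⌊(n : ℝ) * t⌋₊ with hk
  have hint : ∀ i, Integrable (fun ω => Real.exp (θ * ν i ω)) P := fun i =>
    ((hν_ident i).comp (u := fun y => Real.exp (θ * y)) (by fun_prop)).integrable_iff.2 hθ
  have hsum := hν_indep.integrable_exp_mul_sum hν_meas (s := Finset.range k) fun i _ => hint i
  have hmgf : mgf (∑ i ∈ Finset.range k, ν i) P θ = Real.exp (k * φ) := by
    rw [hν_indep.mgf_sum hν_meas, Finset.prod_congr rfl fun i _ =>
      congrFun (mgf_congr_identDistrib (hν_ident i)) θ, Finset.prod_const, Finset.card_range,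
      Real.exp_nat_mul, hφ, exp_cgf hθ]
  -- Applying Chernoff at parameter `1` to `θ` times the sum treats both signs of `θ` at once.
  have hch := measure_ge_le_exp_mul_mgf (μ := P) (t := 1)
    (X := fun ω => θ * (∑ i ∈ Finset.range k, ν i) ω) (n * (w + t * φ)) zero_le_one
    (by simpa using hsum)
  rw [mgf_const_mul, mul_one, hmgf, ← Real.exp_add] at hch
  rw [← ofReal_measureReal]
  refine ENNReal.ofReal_le_ofReal (le_trans (le_of_eq ?_) (hch.trans ?_))
  · congr 1
    ext ω
    simp only [mem_ofPred_eq, serviceProcess, Finset.sum_apply, ← hk]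
    rw [← mul_div_assoc, le_div_iff₀ hn0, mul_comm]
  · rw [← Real.exp_add]
    refine Real.exp_le_exp.2 ?_
    have : ((k : ℝ) - n * t) * φ ≤ |φ| := by
      refine (le_abs_self _).trans ?_
      rw [abs_mul]
      exact mul_le_of_le_one_left (abs_nonneg _) (abs_floor_mul_sub_le ht n)
    linarith

/-- Cramér's bound at `0` for the summands `ν i - x / t`, read along `k = ⌊nt⌋`. The rate `L`
becomes `L / t` per summand, and `L ≥ 0` allows `k` to be replaced by `n * t` in the exponent. -/
lemma eventually_le_measure_serviceProcess (hν_meas : ∀ i, Measurable (ν i))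
    (hν_indep : iIndepFun ν P) (hν_ident : ∀ i, IdentDistrib (ν i) (ν 0) P P)
    (ht : t ∈ Ioc (0 : ℝ) 1) {x L ε δ : ℝ} (hL : serviceRate P (ν 0) t x = L)
    (hε : 0 < ε) (hδ : 0 < δ) :
    ∀ᶠ n : ℕ in atTop, ENNReal.ofReal (Real.exp (-(n * (L + ε)))) ≤
      P {ω | |(serviceProcess ν n t ω) - x| ≤ δ} := by
  have ht0 := ht.1
  have hL0 : 0 ≤ L := by
    have := serviceRate_nonneg (P := P) (V := ν 0) (t := t) x
    rw [hL] at this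
    exact_mod_cast this
  set c := x / t with hc
  have hcm : ∀ i, Measurable fun ω => ν i ω - c := fun i => (hν_meas i).sub_const c
  set μ := P.map (fun ω => ν 0 ω - c) with hμ
  have : IsProbabilityMeasure μ := Measure.isProbabilityMeasure_map (hcm 0).aemeasurable
  have hmap : ∀ m : ℕ, P.map (fun ω (i : Fin m) => ν i ω - c) =
      Measure.pi (fun _ : Fin m => μ) := by
    intro m
    have hind : iIndepFun (fun (i : Fin m) ω => ν i ω - c) P :=
      (hν_indep.precomp Fin.val_injective).comp (fun _ y => y - c) fun _ => by fun_prop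
    rw [hind.map_fun_eq_pi_map fun i : Fin m => (hcm i).aemeasurable]
    congr 1
    ext1 i
    exact ((hν_ident i).comp (u := fun y => y - c) (by fun_prop)).map_eq
  have hlow : ∀ θ ∈ integrableExpSet id μ, Real.exp (-(L / t)) ≤ mgf id μ θ := by
    intro θ hθ
    have hexp : ∀ ω, Real.exp (θ * (ν 0 ω - c)) = Real.exp (-(θ * c)) * Real.exp (θ * ν 0 ω) := by
      intro ω
      rw [← Real.exp_add]; congr 1; ring
    have h1 : Integrable (fun ω => Real.exp (θ * (ν 0 ω - c))) P :=
      (integrable_map_measure (by fun_prop) (hcm 0).aemeasurable).1 hθ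
    simp_rw [hexp] at h1
    have h2 : θ ∈ integrableExpSet (ν 0) P :=
      (integrable_const_mul_iff (isUnit_iff_ne_zero.2 (Real.exp_pos _).ne') _).1 h1
    have h3 := le_serviceRate (t := t) h2 x
    rw [hL, EReal.coe_le_coe_iff] at h3
    rw [mgf_id_map (hcm 0).aemeasurable, mgf]
    simp_rw [hexp]
    rw [integral_const_mul]
    change _ ≤ _ * mgf (ν 0) P θ
    rw [← exp_cgf h2, ← Real.exp_add]
    refine Real.exp_le_exp.2 ?_
    rw [hc, ← sub_nonneg]
    have h4 : 0 ≤ (L - (θ * x - t * cgf (ν 0) P θ)) / t := div_nonneg (by linarith) ht0.le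
    refine h4.trans (le_of_eq ?_)
    field_simp
    ring
  have hev := (tendsto_floor_mul ht).eventually
    (eventually_le_pi_abs_sum_le hlow hε (half_pos hδ))
  have hbig : ∀ᶠ n : ℕ in atTop, |c| ≤ n * (δ / 2) :=
    (tendsto_natCast_atTop_atTop.atTop_mul_const (half_pos hδ)).eventually_ge_atTop _
  filter_upwards [hev, hbig, eventually_gt_atTop 0] with n hn hb hn0
  have hn0' : (0 : ℝ) < n := by exact_mod_cast hn0
  have hkt := abs_floor_mul_sub_le ht n
  have hkn : (⌊(n : ℝ) * t⌋₊ : ℝ) ≤ n := by exact_mod_cast floor_mul_le ht n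
  have hkt' := Nat.floor_le (mul_nonneg n.cast_nonneg ht0.le)
  set k := ⌊(n : ℝ) * t⌋₊ with hk
  rw [← hmap, Measure.map_apply (measurable_pi_iff.2 fun i : Fin k => hcm i)
    (measurableSet_le (by fun_prop) (by fun_prop))] at hn
  refine le_trans (ENNReal.ofReal_le_ofReal (Real.exp_le_exp.2 ?_))
    (hn.trans (measure_mono fun ω hω => ?_))
  · rw [neg_le_neg_iff]
    calc (k : ℝ) * (L / t + ε) ≤ (n * t) * (L / t) + n * ε := by
          rw [mul_add]
          have : 0 ≤ L / t := by positivity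
          gcongr
      _ = n * (L + ε) := by field_simp
  · have hω' : |∑ i : Fin k, (ν i ω - c)| ≤ k * (δ / 2) := hω
    rw [Fin.sum_univ_eq_sum_range (fun i => ν i ω - c), Finset.sum_sub_distrib,
      Finset.sum_const, Finset.card_range, nsmul_eq_mul] at hω'
    simp only [mem_ofPred_eq, serviceProcess, ← hk]
    have hx : x = c * t := by rw [hc]; field_simp
    have heq : (∑ i ∈ Finset.range k, ν i ω) / n - x =
        ((∑ i ∈ Finset.range k, ν i ω - k * c) + (k - n * t) * c) / n := by
      rw [hx]; field_simp; ring
    rw [heq, abs_div, abs_of_pos hn0', div_le_iff₀ hn0']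
    refine (abs_add_le _ _).trans ?_
    have h1 : |((k : ℝ) - n * t) * c| ≤ |c| := by
      rw [abs_mul]
      exact mul_le_of_le_one_left (abs_nonneg _) hkt
    have h2 : (k : ℝ) * (δ / 2) ≤ n * (δ / 2) := by gcongr
    linarith

end Services

/-! ### The joint law and the two large deviation bounds -/

lemma exists_real_lt_add {a b : EReal} {c : ℝ} (h : (c : EReal) < a + b) :
    ∃ x y : ℝ, (x : EReal) < a ∧ (y : EReal) < b ∧ c < x + y := by
  by_contra! hc
  refine h.not_ge (EReal.add_le_of_forall_lt fun a' ha b' hb => ?_)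
  induction a' with
  | bot => simp
  | top => exact absurd ha not_top_lt
  | coe x =>
    induction b' with
    | bot => simp
    | top => exact absurd hb not_top_lt
    | coe y => exact_mod_cast hc x y ha hb

variable {Ω : Type*} [MeasurableSpace Ω] {P : Measure Ω}
  {T : (n : ℕ) → Fin n → Ω → ℝ} {ν : ℕ → Ω → ℝ} {t : ℝ}

lemma map_eq_uniformLaw {n : ℕ} {T : Fin n → Ω → ℝ} (hT_meas : ∀ i, Measurable (T i))
    (hT_indep : iIndepFun T P) (hT_unif : ∀ i, pdf.IsUniform (T i) (Icc (0 : ℝ) 1) P volume) :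
    P.map (fun ω i => T i ω) = uniformLaw n := by
  rw [hT_indep.map_fun_eq_pi_map fun i => (hT_meas i).aemeasurable, uniformLaw]
  congr 1
  ext1 i
  rw [show P.map (T i) = ProbabilityTheory.cond volume (Icc (0 : ℝ) 1) from hT_unif i,
    ProbabilityTheory.cond]
  simp

lemma ae_mem_Icc_of_isUniform {V : Ω → ℝ} (hV : Measurable V)
    (h : pdf.IsUniform V (Icc (0 : ℝ) 1) P volume) : ∀ᵐ ω ∂P, V ω ∈ Icc (0 : ℝ) 1 := by
  have h1 : ∀ᵐ y ∂(P.map V), y ∈ Icc (0 : ℝ) 1 := by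
    rw [show P.map V = ProbabilityTheory.cond volume (Icc (0 : ℝ) 1) from h]
    exact ProbabilityTheory.ae_cond_mem measurableSet_Icc
  exact ae_of_ae_map hV.aemeasurable h1

lemma indepFun_arrivalProcess_serviceProcess {n : ℕ}
    (hTν : IndepFun (fun ω (i : Fin n) => T n i ω) (fun ω (i : ℕ) => ν i ω) P) :
    IndepFun (arrivalProcess T n t) (serviceProcess ν n t) P :=
  hTν.comp (φ := fun v => orderStat v ⌊(n : ℝ) * t⌋₊)
    (ψ := fun y : ℕ → ℝ => (∑ i ∈ Finset.range ⌊(n : ℝ) * t⌋₊, y i) / n)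
    (measurable_orderStat _) (by fun_prop)

lemma measure_arrivalProcess_mem [IsProbabilityMeasure P]
    (hT_meas : ∀ n i, Measurable (T n i))
    (hT_indep : ∀ n, iIndepFun (T n) P)
    (hT_unif : ∀ n i, pdf.IsUniform (T n i) (Icc (0 : ℝ) 1) P volume) (n : ℕ) {s : Set ℝ}
    (hs : MeasurableSet s) :
    P {ω | arrivalProcess T n t ω ∈ s} =
      uniformLaw n {w | orderStat w ⌊(n : ℝ) * t⌋₊ ∈ s} := by
  rw [← map_eq_uniformLaw (hT_meas n) (hT_indep n) (hT_unif n)]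
  exact (Measure.map_apply (measurable_pi_iff.2 fun i => hT_meas n i)
    (measurable_orderStat _ hs)).symm

lemma arrivalProcess_mem_Icc {Ω : Type*} {T : (n : ℕ) → Fin n → Ω → ℝ} {n : ℕ} {ω : Ω} (h : ∀ i, T n i ω ∈ Icc (0 : ℝ) 1) :
    arrivalProcess T n t ω ∈ Icc (0 : ℝ) 1 := by
  unfold arrivalProcess orderStat
  split_ifs
  · exact h _
  · simp

/-- Around each point at which the joint rate exceeds `α` there is a neighbourhood charged at most
at the exponential rate `α`. -/
lemma exists_nhds_measure_le [IsProbabilityMeasure P]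
    (hT_meas : ∀ n i, Measurable (T n i))
    (hT_indep : ∀ n, iIndepFun (T n) P)
    (hT_unif : ∀ n i, pdf.IsUniform (T n i) (Icc (0 : ℝ) 1) P volume)
    (hν_meas : ∀ i, Measurable (ν i)) (hν_indep : iIndepFun ν P)
    (hν_ident : ∀ i, IdentDistrib (ν i) (ν 0) P P)
    (hTν : ∀ n, IndepFun (fun ω (i : Fin n) => T n i ω) (fun ω (i : ℕ) => ν i ω) P)
    (ht : t ∈ Ioc (0 : ℝ) 1) {x : ℝ × ℝ} (hx : x ∈ pairDomain) {α : ℝ}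
    (hα : (α : EReal) < pairRate P (ν 0) t x) :
    ∃ U ∈ 𝓝 x, ∃ C : ℝ, 0 < C ∧ ∀ᶠ n : ℕ in atTop,
      P {ω | (arrivalProcess T n t ω, serviceProcess ν n t ω) ∈ U} ≤
        ENNReal.ofReal (C * Real.exp (-(n * α))) := by
  obtain ⟨r, s, hr, hs, hrs⟩ := exists_real_lt_add hα
  obtain ⟨u, v, hu, hv, huv⟩ := exists_real_lt_add hr
  obtain ⟨θ, hθ, hsθ⟩ : ∃ θ ∈ integrableExpSet (ν 0) P,
      s < θ * x.2 - t * cgf (ν 0) P θ := by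
    simp only [serviceRate, lt_iSup_iff] at hs
    obtain ⟨θ, hθ, h⟩ := hs
    exact ⟨θ, hθ, EReal.coe_lt_coe_iff.1 h⟩
  -- Lower semicontinuity lets both denominators be enlarged slightly. This puts `x.1` in the
  -- interior of `[1 - c, b]` and makes both denominators positive, even at the ends of `[0, 1]`.
  have hright : ∀ {c y w : ℝ}, 0 ≤ c → 0 ≤ y → (w : EReal) < mulLogDiv c y →
      ∃ b > y, (w : EReal) < mulLogDiv c b := by
    intro c y w hc hy hw
    have h1 : ∀ᶠ z in 𝓝[>] y, (w : EReal) < mulLogDiv c z :=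
      (lowerSemicontinuousOn_mulLogDiv hc y hy w hw).filter_mono
        (nhdsWithin_mono y fun z hz => hy.trans (le_of_lt hz))
    obtain ⟨b, h2, h3⟩ := (h1.and self_mem_nhdsWithin).exists
    exact ⟨b, h3, h2⟩
  obtain ⟨b, hb, hub⟩ := hright ht.1.le hx.1.1 hu
  obtain ⟨c, hc, hvc⟩ := hright (sub_nonneg.2 ht.2) (sub_nonneg.2 hx.1.2) hv
  have hb0 : 0 < b := hx.1.1.trans_lt hb
  have hc0 : 0 < c := (sub_nonneg.2 hx.1.2).trans_lt hc
  -- Over a service interval of radius `δ`, the linear function `θ * z` drops by no more than the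
  -- slack above `s`, so the interval lies in the Chernoff half-line.
  set δ := (θ * x.2 - t * cgf (ν 0) P θ - s) / (|θ| + 1) with hδ
  have hδ0 : 0 < δ := div_pos (by linarith) (by positivity)
  have hθδ : |θ| * δ ≤ θ * x.2 - t * cgf (ν 0) P θ - s := by
    calc |θ| * δ ≤ (|θ| + 1) * δ := by gcongr; linarith
      _ = _ := by rw [hδ]; field_simp
  obtain ⟨C₁, hC₁, h₁⟩ := exists_eventually_uniformLaw_orderStat_le ht
    (a := 1 - c) (by linarith) hb0 hub.le (by rw [sub_sub_cancel]; exact hvc.le)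
  obtain ⟨C₂, hC₂, h₂⟩ := exists_measure_serviceProcess_le hν_meas hν_indep hν_ident ht hθ s
  refine ⟨Icc (1 - c) b ×ˢ Icc (x.2 - δ) (x.2 + δ), ?_, C₁ * C₂, by positivity, ?_⟩
  · rw [← Prod.mk.eta (p := x)]
    exact prod_mem_nhds (Icc_mem_nhds (by linarith) hb) (Icc_mem_nhds (by simpa) (by simpa))
  filter_upwards [h₁, h₂] with n hn₁ hn₂
  calc P {ω | (arrivalProcess T n t ω, serviceProcess ν n t ω) ∈
          Icc (1 - c) b ×ˢ Icc (x.2 - δ) (x.2 + δ)}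
      = P (arrivalProcess T n t ⁻¹' Icc (1 - c) b) *
          P (serviceProcess ν n t ⁻¹' Icc (x.2 - δ) (x.2 + δ)) :=
        (indepFun_arrivalProcess_serviceProcess (hTν n)).measure_inter_preimage_eq_mul _ _
          measurableSet_Icc measurableSet_Icc
    _ ≤ ENNReal.ofReal (C₁ * Real.exp (-(n * (u + v)))) *
          ENNReal.ofReal (C₂ * Real.exp (-(n * s))) := by
        refine mul_le_mul' ?_ ((measure_mono fun ω hω => ?_).trans hn₂)
        · exact (measure_arrivalProcess_mem hT_meas hT_indep hT_unif n measurableSet_Icc).trans_le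
            hn₁
        · have h3 : |(serviceProcess ν n t ω) - x.2| ≤ δ := by
            rw [abs_le]
            constructor <;> linarith [hω.1, hω.2]
          have h4 : -(|θ| * δ) ≤ θ * (serviceProcess ν n t ω - x.2) := by
            refine neg_le_of_neg_le ((neg_le_abs _).trans ?_)
            rw [abs_mul]
            gcongr
          simp only [mem_ofPred_eq]
          linarith
    _ ≤ ENNReal.ofReal (C₁ * C₂ * Real.exp (-(n * α))) := by
        rw [← ENNReal.ofReal_mul (by positivity)]
        refine ENNReal.ofReal_le_ofReal ?_
        rw [mul_mul_mul_comm, ← Real.exp_add]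
        gcongr
        nlinarith [Nat.cast_nonneg (α := ℝ) n]

lemma exists_measure_mem_isCompact_le [IsProbabilityMeasure P]
    (hT_meas : ∀ n i, Measurable (T n i))
    (hT_indep : ∀ n, iIndepFun (T n) P)
    (hT_unif : ∀ n i, pdf.IsUniform (T n i) (Icc (0 : ℝ) 1) P volume)
    (hν_meas : ∀ i, Measurable (ν i)) (hν_indep : iIndepFun ν P)
    (hν_ident : ∀ i, IdentDistrib (ν i) (ν 0) P P)
    (hTν : ∀ n, IndepFun (fun ω (i : Fin n) => T n i ω) (fun ω (i : ℕ) => ν i ω) P)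
    (ht : t ∈ Ioc (0 : ℝ) 1) {K : Set (ℝ × ℝ)} (hK : IsCompact K) (hKD : K ⊆ pairDomain) {α : ℝ}
    (hα : ∀ x ∈ K, (α : EReal) < pairRate P (ν 0) t x) :
    ∃ C : ℝ, 0 < C ∧ ∀ᶠ n : ℕ in atTop,
      P {ω | (arrivalProcess T n t ω, serviceProcess ν n t ω) ∈ K} ≤
        ENNReal.ofReal (C * Real.exp (-(n * α))) := by
  refine hK.induction_on (p := fun U => ∃ C : ℝ, 0 < C ∧ ∀ᶠ n : ℕ in atTop,
      P {ω | (arrivalProcess T n t ω, serviceProcess ν n t ω) ∈ U} ≤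
        ENNReal.ofReal (C * Real.exp (-(n * α)))) ?_ ?_ ?_ ?_
  · exact ⟨1, one_pos, Eventually.of_forall fun n => by simp⟩
  · rintro U U' hUU' ⟨C, hC, h⟩
    exact ⟨C, hC, h.mono fun n hn => le_trans (measure_mono fun ω hω => hUU' hω) hn⟩
  · rintro U U' ⟨C, hC, h⟩ ⟨C', hC', h'⟩
    refine ⟨C + C', by positivity, ?_⟩
    filter_upwards [h, h'] with n hn hn'
    rw [add_mul, ENNReal.ofReal_add (by positivity) (by positivity)]
    exact (measure_union_le _ _).trans (add_le_add hn hn')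
  · intro x hx
    obtain ⟨U, hU, h⟩ := exists_nhds_measure_le hT_meas hT_indep hT_unif hν_meas hν_indep hν_ident
      hTν ht (hKD hx) (hα x hx)
    exact ⟨U, mem_nhdsWithin_of_mem_nhds hU, h⟩

lemma limsup_offeredLoad_le [IsProbabilityMeasure P]
    (hT_meas : ∀ n i, Measurable (T n i))
    (hT_indep : ∀ n, iIndepFun (T n) P)
    (hT_unif : ∀ n i, pdf.IsUniform (T n i) (Icc (0 : ℝ) 1) P volume)
    (hν_meas : ∀ i, Measurable (ν i)) (hν_indep : iIndepFun ν P)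
    (hν_ident : ∀ i, IdentDistrib (ν i) (ν 0) P P) (hν_pos : ∀ᵐ ω ∂P, 0 < ν 0 ω)
    (hν_cgf : (0 : ℝ) ∈ interior (integrableExpSet (ν 0) P))
    (hTν : ∀ n, IndepFun (fun ω (i : Fin n) => T n i ω) (fun ω (i : ℕ) => ν i ω) P)
    (ht : t ∈ Ioc (0 : ℝ) 1) {F : Set ℝ} (hF : IsClosed F) :
    limsup (fun n : ℕ => ((1 / (n : ℝ) : ℝ) : EReal) *
        ENNReal.log (P {ω | offeredLoad T ν n t ω ∈ F})) atTop ≤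
      -(⨅ y ∈ F, offeredLoadRate P (ν 0) t y) := by
  rw [EReal.le_neg]
  refine EReal.ge_of_forall_gt_iff_ge.1 fun α hα => ?_
  rw [EReal.le_neg, ← EReal.coe_neg]
  obtain ⟨θ, hθ, hθ0⟩ := exists_pos_mem_integrableExpSet hν_cgf
  -- Chosen so that the Chernoff bound at `θ` for service at least `M` has exponent exactly `α`; the
  -- remaining pairs form a compact set.
  set M := (α + t * cgf (ν 0) P θ) / θ with hM
  have hθM : θ * M = α + t * cgf (ν 0) P θ := by rw [hM]; field_simp
  obtain ⟨C₁, hC₁, h₁⟩ := exists_measure_serviceProcess_le hν_meas hν_indep hν_ident ht hθ α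
  set K : Set (ℝ × ℝ) := (Icc (0 : ℝ) 1 ×ˢ Icc (0 : ℝ) M) ∩ {x | x.2 - x.1 ∈ F} with hK
  have hKc : IsCompact K := (isCompact_Icc.prod isCompact_Icc).inter_right
    (hF.preimage (by fun_prop : Continuous fun x : ℝ × ℝ => x.2 - x.1))
  have hKD : K ⊆ pairDomain := fun x hx => ⟨hx.1.1, hx.1.2.1⟩
  obtain ⟨C₂, hC₂, h₂⟩ := exists_measure_mem_isCompact_le hT_meas hT_indep hT_unif hν_meas hν_indep
    hν_ident hTν ht hKc hKD (α := α) fun x hx =>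
      hα.trans_le ((iInf₂_le (x.2 - x.1) hx.2).trans (offeredLoadRate_le (hKD hx)))
  refine limsup_le_of_eventually_le (C := C₂ + C₁) (by positivity) ?_
  have hTae : ∀ n, ∀ᵐ ω ∂P, ∀ i, T n i ω ∈ Icc (0 : ℝ) 1 := fun n =>
    ae_all_iff.2 fun i => ae_mem_Icc_of_isUniform (hT_meas n i) (hT_unif n i)
  have hνae : ∀ᵐ ω ∂P, ∀ i, 0 < ν i ω :=
    ae_all_iff.2 fun i => (hν_ident i).symm.ae_snd (p := fun y => 0 < y) measurableSet_Ioi hν_pos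
  filter_upwards [h₁, h₂] with n hn₁ hn₂
  rw [add_mul, ENNReal.ofReal_add (by positivity) (by positivity)]
  refine le_trans (measure_mono_ae ?_) ((measure_union_le _ _).trans (add_le_add hn₂ hn₁))
  filter_upwards [hTae n, hνae] with ω hT hν hω
  rcases le_total (serviceProcess ν n t ω) M with h | h
  · refine Or.inl ⟨⟨arrivalProcess_mem_Icc hT, ?_, h⟩, hω⟩
    exact div_nonneg (Finset.sum_nonneg fun i _ => (hν i).le) n.cast_nonneg
  · refine Or.inr ?_
    change α + t * cgf (ν 0) P θ ≤ θ * serviceProcess ν n t ω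
    rw [← hθM]
    gcongr

lemma le_liminf_offeredLoad [IsProbabilityMeasure P]
    (hT_meas : ∀ n i, Measurable (T n i))
    (hT_indep : ∀ n, iIndepFun (T n) P)
    (hT_unif : ∀ n i, pdf.IsUniform (T n i) (Icc (0 : ℝ) 1) P volume)
    (hν_meas : ∀ i, Measurable (ν i)) (hν_indep : iIndepFun ν P)
    (hν_ident : ∀ i, IdentDistrib (ν i) (ν 0) P P)
    (hTν : ∀ n, IndepFun (fun ω (i : Fin n) => T n i ω) (fun ω (i : ℕ) => ν i ω) P)
    (ht : t ∈ Ioc (0 : ℝ) 1) {G : Set ℝ} (hG : IsOpen G) :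
    -(⨅ y ∈ G, offeredLoadRate P (ν 0) t y) ≤
      liminf (fun n : ℕ => ((1 / (n : ℝ) : ℝ) : EReal) *
        ENNReal.log (P {ω | offeredLoad T ν n t ω ∈ G})) atTop := by
  rw [EReal.neg_le]
  refine le_iInf₂ fun y hy => le_iInf₂ fun x hx => ?_
  rw [EReal.neg_le]
  rcases eq_or_ne (arrivalRate t x.1) ⊤ with hA | hA
  · rw [hA, EReal.top_add_of_ne_bot (serviceRate_ne_bot _)]
    simp
  rcases eq_or_ne (serviceRate P (ν 0) t x.2) ⊤ with hS | hS
  · rw [hS, EReal.add_top_of_ne_bot (arrivalRate_ne_bot _ _)]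
    simp
  obtain ⟨hxD, hxy⟩ := hx
  lift arrivalRate t x.1 to ℝ using ⟨hA, arrivalRate_ne_bot _ _⟩ with I hI
  lift serviceRate P (ν 0) t x.2 to ℝ using ⟨hS, serviceRate_ne_bot _⟩ with L hL
  rw [← EReal.coe_add, ← EReal.coe_neg]
  refine le_liminf_of_eventually_le fun ε hε => ?_
  obtain ⟨η, hη, hηG⟩ := Metric.isOpen_iff.1 hG y hy
  have hx0 := (arrivalRate_of_ne_top ht hxD.1 (by rw [← hI]; exact EReal.coe_ne_top _)).1
  -- The arrival interval extends only to the left of `x.1`; finiteness of the rate gives `x.1 > 0`,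
  -- so it is nondegenerate. Two errors of at most `η / 3` keep the difference within `η` of `y`.
  filter_upwards [eventually_le_uniformLaw_orderStat ht (a := max 0 (x.1 - η / 3)) (le_max_left _ _)
      (max_lt hx0 (by linarith)) hxD.1 hI.symm (half_pos hε),
    eventually_le_measure_serviceProcess hν_meas hν_indep hν_ident ht hL.symm (half_pos hε)
      (show 0 < η / 3 by positivity)] with n hn₁ hn₂
  rw [← measure_arrivalProcess_mem hT_meas hT_indep hT_unif n measurableSet_Icc] at hn₁
  calc ENNReal.ofReal (Real.exp (-(n * (I + L + ε))))
      = ENNReal.ofReal (Real.exp (-(n * (I + ε / 2)))) *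
          ENNReal.ofReal (Real.exp (-(n * (L + ε / 2)))) := by
        rw [← ENNReal.ofReal_mul (Real.exp_pos _).le, ← Real.exp_add]
        congr 2; ring
    _ ≤ P (arrivalProcess T n t ⁻¹' Icc (max 0 (x.1 - η / 3)) x.1) *
          P (serviceProcess ν n t ⁻¹' {z | |z - x.2| ≤ η / 3}) := mul_le_mul' hn₁ hn₂
    _ = P (arrivalProcess T n t ⁻¹' Icc (max 0 (x.1 - η / 3)) x.1 ∩
          serviceProcess ν n t ⁻¹' {z | |z - x.2| ≤ η / 3}) :=
        ((indepFun_arrivalProcess_serviceProcess (hTν n)).measure_inter_preimage_eq_mul _ _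
          measurableSet_Icc (measurableSet_le (by fun_prop) (by fun_prop))).symm
    _ ≤ P {ω | offeredLoad T ν n t ω ∈ G} := by
        refine measure_mono fun ω hω => hηG ?_
        have h1 : |(serviceProcess ν n t ω) - x.2| ≤ η / 3 := hω.2
        have h2 := (le_max_right _ _).trans hω.1.1
        have h3 := hω.1.2
        rw [abs_le] at h1
        rw [Metric.mem_ball, Real.dist_eq, offeredLoad, abs_lt]
        constructor <;> linarith [h1.1, h1.2]

end OfferedLoad

end

theorem mainTheorem4 {Ω : Type*} [MeasurableSpace Ω] (P : Measure Ω) [IsProbabilityMeasure P]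
    (T : (n : ℕ) → Fin n → Ω → ℝ) (ν : ℕ → Ω → ℝ)
    -- for every `n`, the `n` arrival epochs are i.i.d. uniform on `[0, 1]`
    (hT_meas : ∀ n i, Measurable (T n i))
    (hT_indep : ∀ n, iIndepFun (T n) P)
    (hT_unif : ∀ n i, pdf.IsUniform (T n i) (Icc (0 : ℝ) 1) P volume)
    -- the service times are i.i.d. and positive
    (hν_meas : ∀ i, Measurable (ν i))
    (hν_indep : iIndepFun ν P)
    (hν_ident : ∀ i, IdentDistrib (ν i) (ν 0) P P)
    (hν_pos : ∀ᵐ ω ∂P, 0 < ν 0 ω)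
    -- the cumulant generating function of the service times is finite near `0`
    (hν_cgf : (0 : ℝ) ∈ interior (integrableExpSet (ν 0) P))
    -- arrival epochs and service times are independent
    (hTν : ∀ n, IndepFun (fun ω (i : Fin n) => T n i ω) (fun ω (i : ℕ) => ν i ω) P)
    (t : ℝ) (ht : t ∈ Ioc (0 : ℝ) 1) :
    OfferedLoad.IsGoodRateFunction (OfferedLoad.offeredLoadRate P (ν 0) t) ∧
      OfferedLoad.SatisfiesLDP P (fun n ω => OfferedLoad.offeredLoad T ν n t ω)
        (OfferedLoad.offeredLoadRate P (ν 0) t) := by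
  exact ⟨OfferedLoad.isGoodRateFunction_offeredLoadRate ht hν_cgf,
    fun _ hG => OfferedLoad.le_liminf_offeredLoad hT_meas hT_indep hT_unif hν_meas hν_indep
      hν_ident hTν ht hG,
    fun _ hF => OfferedLoad.limsup_offeredLoad_le hT_meas hT_indep hT_unif hν_meas hν_indep
      hν_ident hν_pos hν_cgf hTν ht hF⟩
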